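/- Let $k$ be a field and let $H$ be a Hopf algebra over $k$ with comultiplication $\Delta(h)=\sum h_{(1)}\otimes h_{(2)}$ and antipode $S$ (no assumption on $S$ is made). All algebras are associative and unital, and subalgebras contain the unit. An $H$-module algebra is a $k$-algebra $B$ with a left $H$-module structure (compatible with that of $k$) such that $h(ab)=\sum (h_{(1)}a)(h_{(2)}b)$ for all $h\in H$, $a,b\in B$. It is called $H$-semiprime if it has no nonzero nilpotent $H$-stable two-sided ideals. A ring is called semiprimary if its Jacobson radical is nilpotent and the factor ring by the Jacobson radical is semisimple Artinian. A right Gabriel topology on a ring $R$ is a set $\mathcal G$ of right ideals of $R$ such that, for right ideals $I,J$ of $R$ and with $(I:a)=\{x\in R\mid ax\in I\}$: (T1) if $J\in\mathcal G$ and $J\subseteq I$ then $I\in\mathcal G$; (T2) if $I,J\in\mathcal G$ then $I\cap J\in\mathcal G$; (T3) if $I\in\mathcal G$ then $(I:a)\in\mathcal G$ for each $a\in R$; (T4) if $J\in\mathcal G$ and $(I:a)\in\mathcal G$ for all $a\in J$ then $I\in\mathcal G$. A map $R\to R$ is called $\mathcal G$-continuous if it is continuous for the topology on $R$ generated by the cosets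 $x+I$, $x\in R$, $I\in\mathcal G$. **Proposition 3.9.** Let $Q$ be a semiprimary $H$-semiprime $H$-module algebra, and let $A\subseteq Q$ be an $H$-stable subalgebra which is right Noetherian and on which the action of $H$ is locally finite, i.e. $\dim_k Ha<\infty$ for all $a\in A$. Let $\mathcal G$ be a right Gabriel topology on $A$ such that every element of $S(H)$ operates on $A$ as a $\mathcal G$-continuous transformation and such that (a) for each $I\in\mathcal G$ one has $\{q\in Q\mid qI=0\}=0$ and $\{a\in A\mid Ia=0\}=0$; (b) for each $q\in Q$ there exists $I\in\mathcal G$ such that $qI\subseteq A$. Then $Q$ is a classical right quotient ring of $A$: every regular element of $A$ (neither a left nor a right zero divisor in $A$) is invertible in $Q$, and every element of $Q$ can be written as $as^{-1}$ with $a,s\in A$ and $s$ regular in $A$. -/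

import Mathlib

open scoped TensorProduct

noncomputable section

/-- The `k`-linear map `H → M`, `h ↦ h a`, for an element `a` of an `H`-module `M`. Its range is
the `H`-submodule `H a`. -/
def hopfOrbitMap (k H : Type*) {M : Type*} [CommSemiring k] [Semiring H] [Algebra k H]
    [AddCommMonoid M] [Module k M] [Module H M] [IsScalarTower k H M] (a : M) : H →ₗ[k] M :=
  (LinearMap.toSpanSingleton H M a).restrictScalars k

/-- `B` is a (left) `H`-module algebra: it is an `H`-module (with the action of `k ⊆ H` being the
scalar one, `IsScalarTower k H B`) such that `h (a b) = ∑ (h₁ a) (h₂ b)`, where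
`Δ h = ∑ h₁ ⊗ h₂`. For a Hopf algebra `H` the identity `h 1 = ε(h) 1` is a consequence: applying
the product rule to `∑ h₁ (1 · S(h₂) b)` gives `ε(h) b = (h 1) b`. -/
structure IsHopfModuleAlgebra (k H B : Type*) [CommRing k] [Ring H] [HopfAlgebra k H]
    [Ring B] [Algebra k B] [Module H B] [IsScalarTower k H B] : Prop where
  smul_mul : ∀ (h : H) (a b : B), h • (a * b) =
    LinearMap.mul' k B
      (TensorProduct.map (hopfOrbitMap k H a) (hopfOrbitMap k H b) (Coalgebra.comul (R := k) h))

/-- `B` is `H`-semiprime: it has no nonzero nilpotent `H`-stable two-sided ideals. -/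
def IsHopfSemiprime (H B : Type*) [Ring H] [Ring B] [Module H B] : Prop :=
  ∀ I : Ideal B, I.IsTwoSided → (∀ h : H, ∀ x ∈ I, h • x ∈ I) → IsNilpotent I → I = ⊥

/-- The right ideals of a ring `R`. -/
abbrev RightIdeal (R : Type*) [Ring R] := Submodule Rᵐᵒᵖ R

/-- The right ideal `(I : a) = {x ∈ R | a x ∈ I}`. -/
def RightIdeal.quotBy {R : Type*} [Ring R] (I : RightIdeal R) (a : R) : RightIdeal R where
  carrier := {x | a * x ∈ I}
  add_mem' {x y} hx hy := by
    have := I.add_mem hx hy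
    rwa [← mul_add] at this
  zero_mem' := by
    have := I.zero_mem
    rwa [← mul_zero a] at this
  smul_mem' r x hx := by
    have := I.smul_mem r hx
    rwa [← mul_smul_comm] at this

/-- A right Gabriel topology on a ring `R`: a set of right ideals which is upward closed, closed
under binary intersections and under `I ↦ (I : a)`, and which contains `I` as soon as it contains
some `J` and all `(I : a)` with `a ∈ J`. -/
structure IsRightGabrielTopology {R : Type*} [Ring R] (G : Set (RightIdeal R)) : Prop where
  mem_of_le : ∀ I J : RightIdeal R, J ∈ G → J ≤ I → I ∈ G
  inf_mem : ∀ I J : RightIdeal R, I ∈ G → J ∈ G → I ⊓ J ∈ G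
  quotBy_mem : ∀ I : RightIdeal R, I ∈ G → ∀ a : R, I.quotBy a ∈ G
  mem_of_quotBy_mem : ∀ I J : RightIdeal R, J ∈ G → (∀ a ∈ J, I.quotBy a ∈ G) → I ∈ G

/-- The linear topology on `R` generated by the cosets `x + I` with `x ∈ R` and `I ∈ G`. For a
nonempty `G` closed under binary intersections these cosets form a base of the topology, so that
`G` is a base of neighbourhoods of `0`. -/
abbrev rightIdealTopology {R : Type*} [Ring R] (G : Set (RightIdeal R)) : TopologicalSpace R :=
  TopologicalSpace.generateFrom {U : Set R | ∃ x : R, ∃ I ∈ G, U = {y : R | y - x ∈ I}}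

/-- The map `f : R → R` is `G`-continuous. -/
def IsGabrielContinuous {R : Type*} [Ring R] (G : Set (RightIdeal R)) (f : R → R) : Prop :=
  @Continuous R R (rightIdealTopology G) (rightIdealTopology G) f

/-- `Q` is a classical right quotient ring of its subring `R`: all regular elements of `R` are
invertible in `Q`, and each element of `Q` has the form `a s⁻¹` with `a, s ∈ R` and `s` regular
in `R`. -/
structure IsClassicalRightQuotientRing {Q : Type*} [Ring Q] (R : Subring Q) : Prop where
  isUnit_of_isRegular : ∀ s : R, IsRegular s → IsUnit (s : Q)
  exists_eq_mul_inv : ∀ q : Q, ∃ a s : R, IsRegular s ∧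
    ∃ u : Qˣ, (u : Q) = (s : Q) ∧ q = (a : Q) * ((u⁻¹ : Qˣ) : Q)

end

/-!
Write `J` for the Jacobson radical of `Q`, and call a subspace of `Q` dense if it contains a member
of `G`. A regular element `s` of `A` is not a left zero divisor in `Q`, the chain of the right
ideals `sⁿ Q` stabilizes, and so `s` is a unit of `Q`. For the fractions it is enough that each
member of `G` contains an element invertible modulo `J`, hence in `Q`: if `q I ⊆ A` with `I ∈ G` and
`s ∈ I` is such a unit, then `q = (q s) s⁻¹`.

Such an element is found by an argument of Goldie's type in the semisimple ring `Q ⧸ J`: an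
essential right ideal of the image of `A` contains a unit provided that essential right ideals have
zero right annihilators (`exists_isUnit_mem_of_isEssentialRightIdeal`). What this needs about `Q` is
that a dense subspace `W` generates `Q` both as a right and as a left ideal, `W Q = Q`
(`span_op_eq_top`) and `Q W = Q` (`ideal_span_eq_top`). These two facts are where the Hopf algebra
enters.

* The action of `H` is handled through multiplicative matrices `C`, with
  `Δ C_ij = ∑ C_il ⊗ C_lj`. The matrix `S(C)` is inverse to `C`, which replaces bijectivity of the
  antipode. In particular a subspace of `A` stable under `S(H)` is stable under `H`, because
  the action is locally finite (`smul_mem_of_antipode_smul_mem`).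
* For a finitely generated module `X` over a semiprimary ring, the numbers of maps from `X` to the
  simple modules, relative to those of the free module, decide whether a power of `X` is an image of
  a free module of a given rank (`exists_surjective_of_finrank_le`). If `X` has the largest ratio at
  a simple module `S`, then a surjection from a free module onto a power of `X` exists which is
  sharp at `S`, and comparing dimensions shows that for equivariant `X` the coefficients of its
  relations generate under `H` a subspace killing `S` (`op_smul_smul_eq_zero_of_map_eq_zero`).
* Applied to a stable right ideal `B ^ m Q` with `B = E ∩ A`, this produces for each stable ideal
  `E ≠ 0` a stable ideal comaximal with `E` that kills a simple module not killed by `E`.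
  Induction shows that stable ideals are direct summands (`exists_hopfIdeal_isCompl`).
* Two-sided ideals that are dense, or that have zero right annihilators, form families with least
  members (`exists_least_of_inf_mul_closed`). The least dense ideal is stable under `S(H)`, so
  it contains a dense stable ideal. The complement of the latter is killed by a dense subspace,
  so it is zero, and the least dense ideal is `Q`. If `W Q` were proper, the annihilator of a simple
  image of `Q ⧸ W Q` would be a proper dense ideal, since simple modules are finite dimensional over
  their endomorphism rings.
* For `Q W = Q`, the dimension count is applied to `Q ⧸ Q W`, for `W` so small that its
  annihilators in the simple left modules are as large as possible. If a dense subspace killed a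
  nonzero element of a simple left module then, for a suitable simple `S` with annihilator `P` and
  all `C`, the ideal of the elements sent to `P` by `S(C)` would have zero right annihilator, and
  `eq_top_of_antipodeComap` would give `P = Q`.
-/

/-! ### Modules over a ring with a nilpotent ideal and semisimple quotient -/

section Semiprimary

variable {R : Type*} [Ring R] (J : Ideal R)

theorem isSemisimpleModule_of_isTorsionBySet [J.IsTwoSided] [IsSemisimpleRing (R ⧸ J)] {X : Type*}
    [AddCommGroup X] [Module R X] (hX : Module.IsTorsionBySet R X J) : IsSemisimpleModule R X := by
  let := hX.module
  exact hX.isSemisimpleModule_iff.mp inferInstance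

/-- Nakayama's lemma for a nilpotent ideal; no finiteness of `X` is needed. -/
theorem eq_top_of_sup_smul_eq_top {N : ℕ} (hJ : J ^ N = ⊥) {X : Type*} [AddCommGroup X]
    [Module R X] (Y : Submodule R X) (h : Y ⊔ J • ⊤ = ⊤) : Y = ⊤ := by
  have key : ∀ n : ℕ, Y ⊔ J ^ n • (⊤ : Submodule R X) = ⊤ := by
    intro n
    induction n with
    | zero => simp [Submodule.pow_zero, Ideal.one_eq_top]
    | succ n ih =>
      rw [eq_top_iff, Submodule.pow_succ, Submodule.mul_smul]
      refine ih.ge.trans ?_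
      refine sup_le le_sup_left ?_
      conv_lhs => rw [← h]
      rw [Submodule.smul_sup]
      exact sup_le_sup_right Submodule.smul_le_right _
  simpa [hJ] using key N

theorem isTorsionBySet_of_isSimpleModule {N : ℕ} (hJ : J ^ N = ⊥) {S : Type*} [AddCommGroup S]
    [Module R S] [IsSimpleModule R S] : Module.IsTorsionBySet R S J := by
  rcases eq_bot_or_eq_top (J • (⊤ : Submodule R S)) with h | h
  · intro s r
    have := Submodule.smul_mem_smul r.2 (Submodule.mem_top (x := s))
    rw [h] at this
    simpa using this
  · have : (⊥ : Submodule R S) = ⊤ := eq_top_of_sup_smul_eq_top J hJ ⊥ (by simpa using h)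
    exact absurd this bot_ne_top

/-- The map `R ⧸ J → S`, `r ↦ r s`, for an element `s` of a module killed by `J`. -/
def quotientToSpanSingleton {S : Type*} [AddCommGroup S] [Module R S]
    (hS : Module.IsTorsionBySet R S J) (s : S) : (R ⧸ J) →ₗ[R] S :=
  Submodule.liftQ J (LinearMap.toSpanSingleton R S s) fun r hr => by
    simpa using hS (x := s) (a := ⟨r, hr⟩)

theorem quotientToSpanSingleton_one {S : Type*} [AddCommGroup S] [Module R S]
    (hS : Module.IsTorsionBySet R S J) (s : S) :
    quotientToSpanSingleton J hS s (1 : R ⧸ J) = s := by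
  change Submodule.liftQ J _ _ (Submodule.Quotient.mk 1) = s
  rw [Submodule.liftQ_apply]
  simp

instance [J.IsTwoSided] [IsSemisimpleRing (R ⧸ J)] : IsSemisimpleModule R (R ⧸ J) := by
  refine isSemisimpleModule_of_isTorsionBySet J ?_
  intro x r
  obtain ⟨y, rfl⟩ := Submodule.Quotient.mk_surjective J x
  rw [← Submodule.Quotient.mk_smul]
  exact (Submodule.Quotient.mk_eq_zero J).mpr (J.mul_mem_right y r.2)

theorem module_finite_end_linearMap_of_isSimpleModule {m S : Type*} [AddCommGroup m] [Module R m]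
    [IsSimpleModule R m] [AddCommGroup S] [Module R S] [IsSimpleModule R S] :
    Module.Finite (Module.End R S) (m →ₗ[R] S) := by
  by_cases h : ∀ φ : m →ₗ[R] S, φ = 0
  · have : Subsingleton (m →ₗ[R] S) := ⟨fun a b => by rw [h a, h b]⟩
    infer_instance
  · push Not at h
    obtain ⟨φ, hφ⟩ := h
    let e := LinearEquiv.ofBijective φ (LinearMap.bijective_of_ne_zero hφ)
    refine ⟨⟨{φ}, ?_⟩⟩
    rw [eq_top_iff]
    rintro ψ -
    rw [Finset.coe_singleton, Submodule.mem_span_singleton]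
    refine ⟨ψ ∘ₗ e.symm.toLinearMap, ?_⟩
    ext x
    change ψ (e.symm (e x)) = ψ x
    simp

/-- A simple module over a ring that is semisimple modulo a nilpotent ideal is finite dimensional
over its endomorphism ring. -/
theorem module_finite_end_of_isSimpleModule [J.IsTwoSided] [IsSemisimpleRing (R ⧸ J)] {N : ℕ}
    (hJ : J ^ N = ⊥)
    (S : Type*) [AddCommGroup S] [Module R S] [IsSimpleModule R S] :
    Module.Finite (Module.End R S) S := by
  obtain ⟨n, m, e, hm⟩ := IsSemisimpleModule.exists_linearEquiv_fin_dfinsupp R (R ⧸ J)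
  have hfin : ∀ i, Module.Finite (Module.End R S) (m i →ₗ[R] S) := fun i => by
    have := hm i
    exact module_finite_end_linearMap_of_isSimpleModule
  let f : (∀ i, m i →ₗ[R] S) →ₗ[Module.End R S] S :=
    { toFun := fun φ => ∑ i, φ i (e 1 i)
      map_add' := fun φ ψ => by simp [Finset.sum_add_distrib]
      map_smul' := fun c φ => by simp [Finset.smul_sum] }
  refine Module.Finite.of_surjective f fun s => ?_
  have hS := isTorsionBySet_of_isSimpleModule J hJ (S := S)
  let g : (Π₀ i : Fin n, m i) →ₗ[R] S := quotientToSpanSingleton J hS s ∘ₗ e.symm.toLinearMap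
  refine ⟨fun i => g ∘ₗ DFinsupp.lsingle (M := fun i => m i) i, ?_⟩
  have : g (e 1) = s := by
    simp [g, quotientToSpanSingleton_one]
  rw [← this]
  change ∑ i, g (DFinsupp.single i (e 1 i)) = g (e 1)
  rw [← map_sum]
  congr 1
  ext i
  simp [DFinsupp.single_apply]

/-- Over a ring that is semisimple modulo a nilpotent ideal there are finitely many simple modules
up to isomorphism. -/
theorem exists_finite_isMaximal_family [J.IsTwoSided] [IsSemisimpleRing (R ⧸ J)] {N : ℕ}
    (hJ : J ^ N = ⊥) :
    ∃ (t : ℕ) (𝔪 : Fin t → Ideal R), (∀ i, (𝔪 i).IsMaximal) ∧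
      ∀ 𝔫 : Ideal R, 𝔫.IsMaximal → ∃ i, Nonempty ((R ⧸ 𝔫) ≃ₗ[R] (R ⧸ 𝔪 i)) := by
  obtain ⟨n, m, e, hm⟩ := IsSemisimpleModule.exists_linearEquiv_fin_dfinsupp R (R ⧸ J)
  have h1 : ∀ i, ∃ 𝔪 : Ideal R, 𝔪.IsMaximal ∧ Nonempty (m i ≃ₗ[R] (R ⧸ 𝔪)) := fun i =>
    isSimpleModule_iff_quot_maximal.mp (hm i)
  choose 𝔪 h𝔪 e' using h1
  refine ⟨n, 𝔪, h𝔪, fun 𝔫 h𝔫 => ?_⟩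
  have hs : IsSimpleModule R (R ⧸ 𝔫) := isSimpleModule_iff_isCoatom.mpr h𝔫.1
  have hS := isTorsionBySet_of_isSimpleModule J hJ (S := R ⧸ 𝔫)
  have := IsSimpleModule.nontrivial R (R ⧸ 𝔫)
  obtain ⟨s, hs0⟩ := exists_ne (0 : R ⧸ 𝔫)
  let g : (Π₀ i : Fin n, m i) →ₗ[R] (R ⧸ 𝔫) :=
    quotientToSpanSingleton J hS s ∘ₗ e.symm.toLinearMap
  have hg : g ≠ 0 := by
    intro h
    apply hs0
    have : g (e 1) = s := by simp [g, quotientToSpanSingleton_one]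
    rw [← this, h, LinearMap.zero_apply]
  obtain ⟨i, hi⟩ : ∃ i, g ∘ₗ DFinsupp.lsingle (M := fun i => m i) i ≠ 0 := by
    by_contra! h
    exact hg (DFinsupp.lhom_ext' fun i => by rw [h i, LinearMap.zero_comp])
  have := hm i
  exact ⟨i, ⟨(LinearEquiv.ofBijective _ (LinearMap.bijective_of_ne_zero hi)).symm.trans
    (e' i).some⟩⟩

/-- A descending chain of finitely generated submodules stabilizes. -/
theorem exists_stable_of_antitone_fg [J.IsTwoSided] [IsSemisimpleRing (R ⧸ J)] {N : ℕ}
    (hJ : J ^ N = ⊥)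
    {X : Type*} [AddCommGroup X] [Module R X] (M : ℕ → Submodule R X) (hM : Antitone M)
    (hfg : ∀ m, (M m).FG) : ∃ m, ∀ n, m ≤ n → M n = M m := by
  have key : ∀ j : ℕ, ∃ m, ∀ n, m ≤ n →
      M n ⊔ J ^ j • (⊤ : Submodule R X) = M m ⊔ J ^ j • ⊤ := by
    intro j
    induction j with
    | zero => exact ⟨0, fun n _ => by simp [Submodule.pow_zero, Ideal.one_eq_top]⟩
    | succ j ih =>
      obtain ⟨m, hm⟩ := ih
      -- beyond `m` all members of the chain contain `J (M m)` modulo `J ^ (j + 1) X`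
      set T : Submodule R X := J ^ (j + 1) • ⊤ with hT
      have hJT : J • (J ^ j • (⊤ : Submodule R X)) = T := by
        rw [hT, Ideal.IsTwoSided.pow_succ, Submodule.mul_smul]
      set W : Submodule R X := J • M m ⊔ T with hW
      have hWle : ∀ n, m ≤ n → W ≤ M n ⊔ T := by
        intro n hn
        refine sup_le ?_ le_sup_right
        calc J • M m ≤ J • (M m ⊔ J ^ j • (⊤ : Submodule R X)) :=
              Submodule.smul_mono le_rfl le_sup_left
          _ = J • M n ⊔ T := by rw [← hm n hn, Submodule.smul_sup, hJT]
          _ ≤ M n ⊔ T := sup_le_sup_right Submodule.smul_le_right _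
      have htor : Module.IsTorsionBySet R ((M m).map W.mkQ) J := by
        rintro ⟨x, hx⟩ r
        obtain ⟨y, hy, rfl⟩ := hx
        ext
        change (r : R) • W.mkQ y = 0
        rw [← map_smul, Submodule.mkQ_apply, Submodule.Quotient.mk_eq_zero]
        exact (le_sup_left : J • M m ≤ W) (Submodule.smul_mem_smul r.2 hy)
      have hss := isSemisimpleModule_of_isTorsionBySet J htor
      have hfin : Module.Finite R ((M m).map W.mkQ) :=
        Module.Finite.iff_fg.mpr ((hfg m).map _)
      let c : ℕ →o (Submodule R ((M m).map W.mkQ))ᵒᵈ :=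
        { toFun := fun i => OrderDual.toDual (((M (m + i)).map W.mkQ).comap (Submodule.subtype _))
          monotone' := fun a b hab => OrderDual.toDual_le_toDual.mpr
            (Submodule.comap_mono (Submodule.map_mono (hM (by omega)))) }
      obtain ⟨i, hi⟩ := IsArtinian.monotone_stabilizes c
      refine ⟨m + i, fun n hn => ?_⟩
      have h2 : (M n).map W.mkQ = (M (m + i)).map W.mkQ := by
        have h3 := hi (n - m) (by omega)
        have h3' : ((M (m + i)).map W.mkQ).comap ((M m).map W.mkQ).subtype =
          ((M (m + (n - m))).map W.mkQ).comap ((M m).map W.mkQ).subtype := h3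
        rw [show m + (n - m) = n by omega] at h3'
        have h4 := congrArg (Submodule.map ((M m).map W.mkQ).subtype) h3'
        rw [Submodule.map_comap_subtype, Submodule.map_comap_subtype,
          inf_eq_right.mpr (Submodule.map_mono (hM (by omega))),
          inf_eq_right.mpr (Submodule.map_mono (hM (by omega)))] at h4
        exact h4.symm
      have h5 := congrArg (Submodule.comap W.mkQ) h2
      rw [Submodule.comap_map_mkQ, Submodule.comap_map_mkQ] at h5
      have h6 : ∀ n, m ≤ n → W ⊔ M n = M n ⊔ T := fun n hn =>
        le_antisymm (sup_le (hWle n hn) le_sup_left)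
          (sup_le le_sup_right ((le_sup_right : T ≤ W).trans le_sup_left))
      rw [← h6 n (by omega), ← h6 (m + i) (by omega), h5]
  obtain ⟨m, hm⟩ := key N
  exact ⟨m, fun n hn => by simpa [hJ] using hm n hn⟩

end Semiprimary

/-! ### Surjections onto finitely generated modules -/

section Surjection

/-- The index `j` is one at which `r / n` is largest. -/
theorem exists_ratio_maximal {t : ℕ} (r n : Fin t → ℕ) (hn : ∀ i, 0 < n i) (hr : ∃ i, 0 < r i) :
    ∃ j, 0 < r j ∧ ∀ i, r i * n j ≤ r j * n i := by
  obtain ⟨i₀, hi₀⟩ := hr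
  obtain ⟨j, -, hj⟩ := Finset.exists_max_image Finset.univ
    (fun i => (r i : ℚ) / n i) ⟨i₀, Finset.mem_univ _⟩
  have key : ∀ i, r i * n j ≤ r j * n i := fun i => by
    have := hj i (Finset.mem_univ _)
    rw [div_le_div_iff₀ (by exact_mod_cast hn i) (by exact_mod_cast hn j)] at this
    exact_mod_cast this
  refine ⟨j, ?_, key⟩
  have h1 := key i₀
  have h2 := Nat.mul_pos hi₀ (hn j)
  exact Nat.pos_of_mul_pos_right (h2.trans_le h1)

variable {R : Type*} [Ring R]

/-- Maps from a finitely generated module into a module which is finitely generated over a division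
ring of endomorphisms form a finitely generated space. -/
theorem module_finite_linearMap {Δ X S : Type*} [DivisionRing Δ] [AddCommGroup X] [Module R X]
    [Module.Finite R X] [AddCommGroup S] [Module R S] [Module Δ S] [SMulCommClass R Δ S]
    [Module.Finite Δ S] : Module.Finite Δ (X →ₗ[R] S) := by
  obtain ⟨n, s, hs⟩ := Module.Finite.exists_fin (R := R) (M := X)
  let f : (X →ₗ[R] S) →ₗ[Δ] (Fin n → S) :=
    { toFun := fun φ i => φ (s i)
      map_add' := fun _ _ => rfl
      map_smul' := fun _ _ => rfl }
  refine Module.Finite.of_injective f fun φ ψ h => ?_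
  refine LinearMap.ext_on_range hs fun i => congrFun h i

theorem finrank_linearMap_pi (Δ X S : Type*) [DivisionRing Δ] [AddCommGroup X] [Module R X]
    [Module.Finite R X] [AddCommGroup S] [Module R S] [Module Δ S] [SMulCommClass R Δ S]
    [Module.Finite Δ S] (k : ℕ) :
    Module.finrank Δ ((Fin k → X) →ₗ[R] S) = k * Module.finrank Δ (X →ₗ[R] S) := by
  let e : (Fin k → X →ₗ[R] S) ≃ₗ[Δ] ((Fin k → X) →ₗ[R] S) := LinearMap.lsum R (fun _ => X) Δ
  have : Module.Finite Δ (X →ₗ[R] S) := module_finite_linearMap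
  rw [← e.finrank_eq, Module.finrank_pi_fintype]
  simp

theorem finrank_linearMap_fun (Δ S : Type*) [DivisionRing Δ] [AddCommGroup S] [Module R S]
    [Module Δ S] [SMulCommClass R Δ S] [Module.Finite Δ S] (n : ℕ) :
    Module.finrank Δ ((Fin n → R) →ₗ[R] S) = n * Module.finrank Δ S := by
  rw [finrank_linearMap_pi, (LinearMap.ringLmapEquivSelf R Δ S).finrank_eq]

theorem exists_factor_of_ker_le {X Y Z : Type*} [AddCommGroup X] [Module R X] [AddCommGroup Y]
    [Module R Y] [AddCommGroup Z] [Module R Z] (f : X →ₗ[R] Y) (hf : Function.Surjective f)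
    (u : X →ₗ[R] Z) (hu : LinearMap.ker f ≤ LinearMap.ker u) :
    ∃ g : Y →ₗ[R] Z, ∀ x, g (f x) = u x := by
  refine ⟨(LinearMap.ker f).liftQ u hu ∘ₗ (f.quotKerEquivOfSurjective hf).symm.toLinearMap,
    fun x => ?_⟩
  have : (f.quotKerEquivOfSurjective hf).symm (f x) = (LinearMap.ker f).mkQ x := by
    rw [LinearEquiv.symm_apply_eq]; rfl
  exact congrArg ((LinearMap.ker f).liftQ u hu) this

/-- A finitely generated module `X` over a ring that is semisimple modulo a nilpotent ideal is an
image of a finitely generated projective module `Y` as soon as `Y` has, for each simple module `S`,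
at least as many maps to `S` as `X` has. -/
theorem exists_surjective_of_finrank_le (J : Ideal R) [J.IsTwoSided] [IsSemisimpleRing (R ⧸ J)]
    {N : ℕ} (hJ : J ^ N = ⊥) {X Y : Type*} [AddCommGroup X] [Module R X] [Module.Finite R X]
    [AddCommGroup Y] [Module R Y] [Module.Finite R Y] [Module.Projective R Y]
    (h : ∀ 𝔪 : Ideal R, 𝔪.IsMaximal →
      Module.finrank (Module.End R (R ⧸ 𝔪)) (X →ₗ[R] (R ⧸ 𝔪)) ≤
        Module.finrank (Module.End R (R ⧸ 𝔪)) (Y →ₗ[R] (R ⧸ 𝔪))) :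
    ∃ f : Y →ₗ[R] X, Function.Surjective f := by
  classical
  set K : Submodule R X := J • ⊤ with hK
  have htor : Module.IsTorsionBySet R (X ⧸ K) J := by
    intro x r
    obtain ⟨y, rfl⟩ := K.mkQ_surjective x
    change (r : R) • K.mkQ y = 0
    rw [← map_smul, Submodule.mkQ_apply, Submodule.Quotient.mk_eq_zero]
    exact Submodule.smul_mem_smul r.2 trivial
  have hss := isSemisimpleModule_of_isTorsionBySet J htor
  obtain ⟨_, ⟨f, rfl⟩, hf⟩ := (wellFounded_gt (α := Submodule R (X ⧸ K))).has_min
    (Set.range fun f : Y →ₗ[R] (X ⧸ K) => LinearMap.range f) ⟨_, 0, rfl⟩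
  have hsurj : LinearMap.range f = ⊤ := by
    by_contra hne
    obtain ⟨m, hm, hfm⟩ := (eq_top_or_exists_le_coatom (LinearMap.range f)).resolve_left hne
    have : IsSimpleModule R ((X ⧸ K) ⧸ m) := isSimpleModule_iff_isCoatom.mpr hm
    obtain ⟨𝔪, h𝔪, ⟨e⟩⟩ := isSimpleModule_iff_quot_maximal.mp this
    let S := R ⧸ 𝔪
    have hS : IsSimpleModule R S := isSimpleModule_iff_isCoatom.mpr h𝔪.1
    let g : (X ⧸ K) →ₗ[R] S := e.toLinearMap ∘ₗ m.mkQ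
    have hgf : g ∘ₗ f = 0 := by
      ext y
      change e (m.mkQ (f y)) = 0
      rw [Submodule.mkQ_apply, (Submodule.Quotient.mk_eq_zero m).mpr (hfm ⟨y, rfl⟩), map_zero]
    have hgs : Function.Surjective g := e.surjective.comp m.mkQ_surjective
    have hfinS : Module.Finite (Module.End R S) S := module_finite_end_of_isSimpleModule J hJ S
    have hf1 : Module.Finite (Module.End R S) (X →ₗ[R] S) := module_finite_linearMap
    have hf2 : Module.Finite (Module.End R S) (Y →ₗ[R] S) := module_finite_linearMap
    have hf3 : Module.Finite (Module.End R S) ((X ⧸ K) →ₗ[R] S) := module_finite_linearMap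
    let p : ((X ⧸ K) →ₗ[R] S) →ₗ[Module.End R S] (X →ₗ[R] S) :=
      { toFun := fun φ => φ ∘ₗ K.mkQ
        map_add' := fun _ _ => rfl
        map_smul' := fun _ _ => rfl }
    have hp : Function.Injective p := fun φ ψ hφ => by
      refine LinearMap.ext fun x => ?_
      obtain ⟨y, rfl⟩ := K.mkQ_surjective x
      exact LinearMap.congr_fun hφ y
    let q : ((X ⧸ K) →ₗ[R] S) →ₗ[Module.End R S] (Y →ₗ[R] S) :=
      { toFun := fun φ => φ ∘ₗ f
        map_add' := fun _ _ => rfl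
        map_smul' := fun _ _ => rfl }
    have hq : ¬ Function.Surjective q := by
      intro hq
      have h1 := LinearMap.finrank_le_finrank_of_injective hp
      have h2 := LinearMap.finrank_le_finrank_of_surjective hq
      have h3 := h1.trans (h 𝔪 h𝔪)
      have h4 := (LinearMap.injective_iff_surjective_of_finrank_eq_finrank
        (le_antisymm h3 h2)).mpr hq
      have h5 : g = 0 := h4 (by rw [map_zero]; exact hgf)
      have := IsSimpleModule.nontrivial R S
      obtain ⟨s, hs⟩ := exists_ne (0 : S)
      obtain ⟨x, rfl⟩ := hgs s
      exact hs (by rw [h5]; rfl)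
    obtain ⟨u, hu⟩ : ∃ u : Y →ₗ[R] S, ∀ φ : (X ⧸ K) →ₗ[R] S, φ ∘ₗ f ≠ u := by
      by_contra! hcon
      exact hq fun u => hcon u
    -- `u` does not vanish on the kernel of `f`, as it would extend to `X ⧸ K` otherwise
    obtain ⟨y₀, hy₀, hu₀⟩ : ∃ y ∈ LinearMap.ker f, u y ≠ 0 := by
      by_contra! hcon
      let e' := f.quotKerEquivRange
      have hker : LinearMap.ker f ≤ LinearMap.ker u := hcon
      let u' : LinearMap.range f →ₗ[R] S :=
        (LinearMap.ker f).liftQ u hker ∘ₗ e'.symm.toLinearMap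
      obtain ⟨φ, hφ⟩ := IsSemisimpleModule.extension_property (LinearMap.range f).subtype
        (Submodule.subtype_injective _) u'
      refine hu φ (LinearMap.ext fun y => ?_)
      have h1 := LinearMap.congr_fun hφ ⟨f y, y, rfl⟩
      change φ (f y) = (LinearMap.ker f).liftQ u hker (e'.symm ⟨f y, y, rfl⟩) at h1
      rw [LinearMap.comp_apply, h1]
      exact congrArg ((LinearMap.ker f).liftQ u hker)
        (LinearMap.quotKerEquivRange_symm_apply_image f y ⟨y, rfl⟩)
    have husurj : (LinearMap.ker f).map u = ⊤ := by
      refine (eq_bot_or_eq_top _).resolve_left fun hb => hu₀ ?_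
      have : u y₀ ∈ (LinearMap.ker f).map u := ⟨y₀, hy₀, rfl⟩
      rwa [hb] at this
    obtain ⟨ι, hι⟩ := IsSemisimpleModule.lifting_property g hgs LinearMap.id
    have hι' : ∀ s, g (ι s) = s := LinearMap.congr_fun hι
    refine hf (LinearMap.range (f + ι ∘ₗ u)) ⟨_, rfl⟩ (lt_of_le_of_ne ?_ ?_)
    · rintro _ ⟨y, rfl⟩
      have : u y ∈ (LinearMap.ker f).map u := by rw [husurj]; trivial
      obtain ⟨z, hz, hzy⟩ := this
      refine ⟨y - z, ?_⟩
      have hz' : f z = 0 := hz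
      simp [hzy, hz']
    · intro heq
      have h1 : (f + ι ∘ₗ u) y₀ ∈ LinearMap.range f := by
        change LinearMap.range f = _ at heq
        rw [heq]; exact ⟨y₀, rfl⟩
      obtain ⟨z, hz⟩ := h1
      have h2 := congrArg g hz
      have hy : f y₀ = 0 := hy₀
      rw [LinearMap.add_apply, hy, zero_add, LinearMap.comp_apply ι, hι'] at h2
      exact hu₀ (h2.symm.trans (LinearMap.congr_fun hgf z))
  obtain ⟨F, hF⟩ := Module.projective_lifting_property K.mkQ f K.mkQ_surjective
  refine ⟨F, LinearMap.range_eq_top.mp (eq_top_of_sup_smul_eq_top J hJ _ ?_)⟩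
  have h1 : (LinearMap.range F).map K.mkQ = ⊤ := by
    rw [← LinearMap.range_comp, hF, hsurj]
  have h2 := congrArg (Submodule.comap K.mkQ) h1
  rw [Submodule.comap_map_mkQ, Submodule.comap_top, sup_comm] at h2
  exact h2

/-- The special case of `exists_surjective_of_finrank_le` in which `X = Z ^ k` and `Y` is free. -/
theorem exists_surjective_pi_of_finrank_le (J : Ideal R) [J.IsTwoSided] [IsSemisimpleRing (R ⧸ J)]
    {N : ℕ} (hJ : J ^ N = ⊥) {Z : Type*} [AddCommGroup Z] [Module R Z] [Module.Finite R Z]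
    (n k : ℕ) (h : ∀ 𝔪 : Ideal R, 𝔪.IsMaximal →
      k * Module.finrank (Module.End R (R ⧸ 𝔪)) (Z →ₗ[R] (R ⧸ 𝔪)) ≤
        n * Module.finrank (Module.End R (R ⧸ 𝔪)) (R ⧸ 𝔪)) :
    ∃ f : (Fin n → R) →ₗ[R] (Fin k → Z), Function.Surjective f := by
  classical
  refine exists_surjective_of_finrank_le J hJ fun 𝔪 h𝔪 => ?_
  have hS : IsSimpleModule R (R ⧸ 𝔪) := isSimpleModule_iff_isCoatom.mpr h𝔪.1
  have hfinS := module_finite_end_of_isSimpleModule J hJ (R ⧸ 𝔪)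
  have h1 := finrank_linearMap_pi (R := R) (Module.End R (R ⧸ 𝔪)) Z (R ⧸ 𝔪) k
  have h2 := finrank_linearMap_fun (R := R) (Module.End R (R ⧸ 𝔪)) (R ⧸ 𝔪) n
  rw [h1, h2]
  exact h 𝔪 h𝔪

end Surjection

/-! ### Multiplicative matrices over a Hopf algebra -/

section MultiplicativeMatrix

/-- A square matrix `C` over a coalgebra is multiplicative if `Δ C_ij = ∑ C_il ⊗ C_lj` and
`ε C_ij = δ_ij`: its entries are the matrix coefficients of a finite dimensional comodule. -/
structure IsMultiplicativeMatrix (k : Type*) {H : Type*} [Field k] [Ring H] [HopfAlgebra k H]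
    {d : ℕ} (C : Fin d → Fin d → H) : Prop where
  comul : ∀ i j, Coalgebra.comul (R := k) (C i j) = ∑ l, C i l ⊗ₜ[k] C l j
  counit : ∀ i j, Coalgebra.counit (R := k) (C i j) = if i = j then 1 else 0

variable {k H : Type*} [Field k] [Ring H] [HopfAlgebra k H]

/-- The contraction `x ⊗ y ↦ φ(x) y`. -/
def tensorContractLeft (M : Type*) [AddCommGroup M] [Module k M] (φ : H →ₗ[k] k) :
    H ⊗[k] M →ₗ[k] M :=
  (TensorProduct.lid k M).toLinearMap ∘ₗ LinearMap.rTensor M φ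

@[simp]
theorem tensorContractLeft_tmul (M : Type*) [AddCommGroup M] [Module k M] (φ : H →ₗ[k] k) (x : H)
    (y : M) : tensorContractLeft M φ (x ⊗ₜ y) = φ x • y := by
  simp [tensorContractLeft]

/-- Each element of a coalgebra lies in a finite dimensional right coideal. -/
theorem exists_finiteDimensional_coideal (h : H) : ∃ F : Submodule k H, FiniteDimensional k F ∧
    h ∈ F ∧ ∀ x ∈ F, Coalgebra.comul (R := k) x ∈
      LinearMap.range (LinearMap.rTensor H F.subtype) := by
  classical
  let b := Module.Basis.ofVectorSpace k H
  obtain ⟨x, hx⟩ := TensorProduct.eq_repr_basis_right b (Coalgebra.comul (R := k) h)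
  refine ⟨Submodule.span k (x.support.image x), inferInstance, ?_, ?_⟩
  · have h1 := Coalgebra.lTensor_counit_comul (R := k) h
    have h2 : h = x.sum fun i m => Coalgebra.counit (R := k) (b i) • m := by
      rw [← hx, map_finsuppSum] at h1
      have h3 := congrArg (TensorProduct.rid k H) h1
      rw [map_finsuppSum] at h3
      simpa using h3.symm
    rw [h2]
    exact Submodule.sum_mem _ fun i hi => Submodule.smul_mem _ _
      (Submodule.subset_span (Finset.mem_coe.mpr (Finset.mem_image_of_mem x hi)))
  · have key : ∀ i, Coalgebra.comul (R := k) (x i) = x.sum fun j m => m ⊗ₜ[k]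
        (TensorProduct.rid k H (LinearMap.lTensor H (b.coord i) (Coalgebra.comul (b j)))) := by
      intro i
      have h1 := Coalgebra.coassoc_apply (R := k) h
      rw [← hx, map_finsuppSum, map_finsuppSum, map_finsuppSum] at h1
      let g : H ⊗[k] (H ⊗[k] H) →ₗ[k] H ⊗[k] H :=
        LinearMap.lTensor H ((TensorProduct.rid k H).toLinearMap ∘ₗ LinearMap.lTensor H (b.coord i))
      have h2 := congrArg g h1
      rw [map_finsuppSum, map_finsuppSum] at h2
      have h3 : ∀ (t : H ⊗[k] H) (y : H), g (TensorProduct.assoc k H H H (t ⊗ₜ y)) =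
          b.coord i y • t := by
        intro t y
        induction t with
        | zero => simp
        | add t₁ t₂ h₁ h₂ => rw [TensorProduct.add_tmul, map_add, map_add, h₁, h₂, smul_add]
        | tmul u v => simp [g]
      simp only [LinearMap.rTensor_tmul, LinearMap.lTensor_tmul, h3] at h2
      rw [Finsupp.sum] at h2
      rw [← show ∑ j ∈ x.support, b.coord i (b j) • Coalgebra.comul (R := k) (x j) =
        Coalgebra.comul (R := k) (x i) from ?_, h2]
      · simp [g]
      · simp only [Module.Basis.coord_apply, Module.Basis.repr_self, Finsupp.single_apply, ite_smul,
          one_smul, zero_smul, Finset.sum_ite_eq']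
        split_ifs with hi
        · rfl
        · rw [Finsupp.notMem_support_iff.mp hi, map_zero]
    intro y hy
    induction hy using Submodule.span_induction with
    | zero => rw [map_zero]; exact Submodule.zero_mem _
    | add y z _ _ h₁ h₂ => rw [map_add]; exact Submodule.add_mem _ h₁ h₂
    | smul c y _ h₁ => rw [map_smul]; exact Submodule.smul_mem _ c h₁
    | mem y hy =>
      obtain ⟨i, -, rfl⟩ := Finset.mem_image.mp (Finset.mem_coe.mp hy)
      rw [key]
      refine Submodule.sum_mem _ fun j hj => ?_
      exact ⟨(⟨x j, Submodule.subset_span (Finset.mem_coe.mpr (Finset.mem_image_of_mem x hj))⟩ :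
        Submodule.span k (x.support.image x : Set H)) ⊗ₜ _, by rw [LinearMap.rTensor_tmul]; rfl⟩

/-- Each element of a coalgebra is a combination of the entries of a multiplicative matrix. -/
theorem exists_isMultiplicativeMatrix (h : H) : ∃ (d : ℕ) (C : Fin d → Fin d → H),
    IsMultiplicativeMatrix k C ∧ h ∈ Submodule.span k {x | ∃ i j, x = C i j} := by
  obtain ⟨F, hF, hh, hΔ⟩ := exists_finiteDimensional_coideal (k := k) h
  let c := Module.finBasis k F
  obtain ⟨π, hπ⟩ := LinearMap.exists_leftInverse_of_injective F.subtype
    (LinearMap.ker_eq_bot.mpr (Submodule.subtype_injective F))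
  have hπ' : ∀ x : F, π (x : H) = x := LinearMap.congr_fun hπ
  let φ : Fin (Module.finrank k F) → H →ₗ[k] k := fun i => c.coord i ∘ₗ π
  have hφ : ∀ i j, φ i (c j) = if i = j then 1 else 0 := fun i j => by
    simp [φ, hπ', Finsupp.single_apply, eq_comm]
  have hexp : ∀ x ∈ F, x = ∑ i, φ i x • (c i : H) := fun x hx => by
    have := congrArg (F.subtype) (c.sum_repr ⟨x, hx⟩)
    rw [map_sum] at this
    simp only [map_smul, Submodule.subtype_apply] at this
    rw [← this]
    refine Finset.sum_congr rfl fun i _ => ?_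
    rw [this]
    simp [φ, hπ' ⟨x, hx⟩]
  let C : Fin (Module.finrank k F) → Fin (Module.finrank k F) → H := fun i j =>
    tensorContractLeft H (φ i) (Coalgebra.comul (R := k) (c j : H))
  have hC : ∀ j, Coalgebra.comul (R := k) (c j : H) = ∑ i, (c i : H) ⊗ₜ[k] C i j := by
    intro j
    have : ∀ t ∈ LinearMap.range (LinearMap.rTensor H F.subtype),
        t = ∑ i, (c i : H) ⊗ₜ[k] tensorContractLeft H (φ i) t := by
      rintro _ ⟨t, rfl⟩
      induction t with
      | zero => simp
      | add t₁ t₂ h₁ h₂ =>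
        simp only [map_add, TensorProduct.tmul_add, Finset.sum_add_distrib]
        rw [← h₁, ← h₂]
      | tmul f y =>
        simp only [LinearMap.rTensor_tmul, Submodule.subtype_apply, tensorContractLeft_tmul,
          ← TensorProduct.smul_tmul]
        rw [← TensorProduct.sum_tmul, ← hexp f f.2]
    exact this _ (hΔ _ (c j).2)
  have hcu : ∀ i j, Coalgebra.counit (R := k) (C i j) = if i = j then 1 else 0 := by
    intro i j
    have h1 := Coalgebra.lTensor_counit_comul (R := k) (c j : H)
    rw [hC, map_sum] at h1
    have h2 := congrArg (tensorContractLeft k (φ i)) h1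
    simp only [LinearMap.lTensor_tmul, map_sum, tensorContractLeft_tmul, hφ, smul_eq_mul, ite_mul,
      one_mul, zero_mul, Finset.sum_ite_eq, Finset.mem_univ, if_true, mul_one] at h2
    exact h2
  refine ⟨_, C, ⟨fun i j => ?_, hcu⟩, ?_⟩
  · have h1 := Coalgebra.coassoc_apply (R := k) (c j : H)
    rw [hC, map_sum, map_sum, map_sum] at h1
    have h2 := congrArg (tensorContractLeft (H ⊗[k] H) (φ i)) h1
    simp only [LinearMap.rTensor_tmul, LinearMap.lTensor_tmul, hC, TensorProduct.sum_tmul, map_sum,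
      TensorProduct.assoc_tmul, tensorContractLeft_tmul, hφ, ite_smul, one_smul, zero_smul,
      Finset.sum_ite_eq, Finset.mem_univ, if_true] at h2
    exact h2.symm
  · rw [hexp h hh]
    refine Submodule.sum_mem _ fun j _ => Submodule.smul_mem _ _ ?_
    have h1 := Coalgebra.rTensor_counit_comul (R := k) (c j : H)
    have h2 := congrArg (TensorProduct.lid k H) h1
    rw [hC] at h2
    simp only [map_sum, LinearMap.rTensor_tmul, TensorProduct.lid_tmul, one_smul] at h2
    rw [← h2]
    exact Submodule.sum_mem _ fun i _ => Submodule.smul_mem _ _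
      (Submodule.subset_span ⟨i, j, rfl⟩)

theorem mem_of_forall_isMultiplicativeMatrix (P : Submodule k H)
    (hP : ∀ (d : ℕ) (C : Fin d → Fin d → H), IsMultiplicativeMatrix k C → ∀ i j, C i j ∈ P)
    (h : H) : h ∈ P := by
  obtain ⟨d, C, hC, hh⟩ := exists_isMultiplicativeMatrix (k := k) h
  refine (Submodule.span_le.mpr ?_ : _ ≤ P) hh
  rintro _ ⟨i, j, rfl⟩
  exact hP d C hC i j

namespace IsMultiplicativeMatrix

variable {d : ℕ} {C : Fin d → Fin d → H} (hC : IsMultiplicativeMatrix k C)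

include hC

theorem sum_antipode_mul (i j : Fin d) :
    ∑ l, HopfAlgebra.antipode k (C i l) * C l j = if i = j then 1 else 0 := by
  have := HopfAlgebra.mul_antipode_rTensor_comul_apply (R := k) (C i j)
  rw [hC.comul, hC.counit] at this
  simpa [apply_ite] using this

theorem sum_mul_antipode (i j : Fin d) :
    ∑ l, C i l * HopfAlgebra.antipode k (C l j) = if i = j then 1 else 0 := by
  have := HopfAlgebra.mul_antipode_lTensor_comul_apply (R := k) (C i j)
  rw [hC.comul, hC.counit] at this
  simpa [apply_ite] using this

variable {M : Type*} [AddCommGroup M] [Module H M]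

theorem sum_antipode_smul (i j : Fin d) (x : M) :
    ∑ l, HopfAlgebra.antipode k (C i l) • C l j • x = if i = j then x else 0 := by
  simp only [smul_smul]
  rw [← Finset.sum_smul, hC.sum_antipode_mul, ite_smul, one_smul, zero_smul]

theorem sum_smul_antipode (i j : Fin d) (x : M) :
    ∑ l, C i l • HopfAlgebra.antipode k (C l j) • x = if i = j then x else 0 := by
  simp only [smul_smul]
  rw [← Finset.sum_smul, hC.sum_mul_antipode, ite_smul, one_smul, zero_smul]

variable {Q : Type*} [Ring Q] [Algebra k Q] [Module H Q] [IsScalarTower k H Q]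
  (hQ : IsHopfModuleAlgebra k H Q)

include hQ

theorem smul_mul (i j : Fin d) (a b : Q) : C i j • (a * b) = ∑ l, (C i l • a) * (C l j • b) := by
  rw [hQ.smul_mul, hC.comul]
  simp [hopfOrbitMap]

/-- The product rule in the form in which the action is moved off the second factor. -/
theorem smul_mul_eq_sum (i j : Fin d) (a b : Q) :
    (C i j • a) * b = ∑ l, C i l • (a * HopfAlgebra.antipode k (C l j) • b) := by
  simp only [hC.smul_mul hQ]
  rw [Finset.sum_comm]
  simp only [← Finset.mul_sum, hC.sum_smul_antipode, mul_ite, mul_zero, Finset.sum_ite_eq',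
    Finset.mem_univ, if_true]

/-- The antipode reverses the product rule. Both sides give the same result when multiplied by `C`,
which is an invertible matrix. -/
theorem antipode_smul_mul (i j : Fin d) (a b : Q) :
    HopfAlgebra.antipode k (C i j) • (a * b) = ∑ l, (HopfAlgebra.antipode k (C l j) • a) *
      (HopfAlgebra.antipode k (C i l) • b) := by
  set S := HopfAlgebra.antipode k (A := H)
  have h1 : ∀ p, ∑ m, C p m • ∑ l, (S (C l j) • a) * (S (C m l) • b) =
      if p = j then a * b else 0 := by
    intro p
    calc ∑ m, C p m • ∑ l, (S (C l j) • a) * (S (C m l) • b)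
        = ∑ l, ∑ q, (C p q • S (C l j) • a) * ∑ m, C q m • S (C m l) • b := by
          simp only [Finset.smul_sum, hC.smul_mul hQ, Finset.mul_sum]
          rw [Finset.sum_comm]
          exact Finset.sum_congr rfl fun l _ => Finset.sum_comm
      _ = ∑ l, (C p l • S (C l j) • a) * b := by
          simp only [hC.sum_smul_antipode, S, mul_ite, mul_zero, Finset.sum_ite_eq',
            Finset.mem_univ, if_true]
      _ = _ := by rw [← Finset.sum_mul, hC.sum_smul_antipode, ite_mul, zero_mul]
  calc S (C i j) • (a * b) = ∑ p, S (C i p) • if p = j then a * b else 0 := by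
        simp only [smul_ite, smul_zero, Finset.sum_ite_eq', Finset.mem_univ, if_true]
    _ = ∑ m, ∑ p, S (C i p) • C p m • ∑ l, (S (C l j) • a) * (S (C m l) • b) := by
        simp only [← h1]
        rw [Finset.sum_comm]
        exact Finset.sum_congr rfl fun p _ => Finset.smul_sum
    _ = _ := by
        simp only [S, hC.sum_antipode_smul, Finset.sum_ite_eq, Finset.mem_univ, if_true]

end IsMultiplicativeMatrix

end MultiplicativeMatrix

/-! ### Locally finite actions and invariance under the Hopf algebra -/

section Invariance

variable {k H Q : Type*} [Field k] [Ring H] [HopfAlgebra k H]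

/-- On a locally finite module, a subspace stable under the image of the antipode is stable under
the Hopf algebra: for a multiplicative matrix `C`, the matrix `S(C)` acts injectively, hence
bijectively, on tuples of a finite dimensional piece of the subspace, and `C` acts as its
inverse. -/
theorem smul_mem_of_antipode_smul_mem {M : Type*} [AddCommGroup M] [Module k M] [Module H M]
    [IsScalarTower k H M] (U : Submodule k M)
    (hfin : ∀ a ∈ U, FiniteDimensional k (LinearMap.range (hopfOrbitMap k H a)))
    (hU : ∀ h : H, ∀ x ∈ U, HopfAlgebra.antipode k h • x ∈ U) (h : H) {x : M} (hx : x ∈ U) :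
    h • x ∈ U := by
  let P : Submodule k H := U.comap (hopfOrbitMap k H x)
  refine mem_of_forall_isMultiplicativeMatrix P (fun d C hC i₀ j₀ => ?_) h
  change C i₀ j₀ • x ∈ U
  set V : Submodule k M := U ⊓ LinearMap.range (hopfOrbitMap k H x)
  have hV : ∀ h : H, ∀ y ∈ V, HopfAlgebra.antipode k h • y ∈ V := by
    rintro h y ⟨hy, g, rfl⟩
    refine ⟨hU h _ hy, HopfAlgebra.antipode k h * g, ?_⟩
    change (HopfAlgebra.antipode k h * g) • x = _ • g • x
    rw [mul_smul]
  have hVfin : FiniteDimensional k V := by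
    have := hfin x hx
    exact Submodule.finiteDimensional_of_le (inf_le_right : V ≤ _)
  have hxV : x ∈ V := ⟨hx, 1, one_smul H x⟩
  let T : (Fin d → V) →ₗ[k] (Fin d → V) :=
    { toFun := fun z i => ∑ j, ⟨HopfAlgebra.antipode k (C i j) • (z j : M), hV _ _ (z j).2⟩
      map_add' := fun z w => by
        funext i
        ext
        simp [Finset.sum_add_distrib]
      map_smul' := fun c z => by
        funext i
        ext
        simp [Finset.smul_sum, smul_algebra_smul_comm] }
  have hT : ∀ z p, ∑ i, C p i • (T z i : M) = z p := by
    intro z p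
    simp only [T, LinearMap.coe_mk, AddHom.coe_mk, AddSubmonoidClass.coe_finsetSum,
      Finset.smul_sum]
    rw [Finset.sum_comm]
    simp only [hC.sum_smul_antipode, Finset.sum_ite_eq, Finset.mem_univ, if_true]
  have hinj : Function.Injective T := fun z w hzw => by
    funext p
    ext
    rw [← hT z, ← hT w, hzw]
  obtain ⟨z, hz⟩ := LinearMap.injective_iff_surjective.mp hinj (Pi.single j₀ ⟨x, hxV⟩)
  have h1 := hT z i₀
  rw [hz, Finset.sum_eq_single j₀ (fun i _ hi => by simp [hi]) (by simp)] at h1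
  rw [Pi.single_eq_same] at h1
  rw [h1]
  exact (z i₀).2.1

variable [Ring Q] [Algebra k Q] [Module H Q] [IsScalarTower k H Q]

/-- A relation among generators of an equivariant module `X` of rank `n` with respect to a module
`S` (that is, `X` has `n` generators and as many maps to `S` as a free module of rank `n`) has
coefficients that generate, under the Hopf algebra, a subspace killing `S`. -/
theorem op_smul_smul_eq_zero_of_map_eq_zero {X S Δ : Type*} [AddCommGroup X] [Module H X]
    [Module Qᵐᵒᵖ X] [AddCommGroup S] [Module Qᵐᵒᵖ S] [DivisionRing Δ] [Module Δ S]
    [SMulCommClass Qᵐᵒᵖ Δ S] [Module.Finite Δ S] [Module k S] [IsScalarTower k Qᵐᵒᵖ S]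
    (hX : ∀ (d : ℕ) (C : Fin d → Fin d → H), IsMultiplicativeMatrix k C → ∀ i j (q : Qᵐᵒᵖ) (x : X),
      C i j • (q • x) = ∑ l, MulOpposite.op (C l j • MulOpposite.unop q) • (C i l • x))
    {n : ℕ} (f : (Fin n → Qᵐᵒᵖ) →ₗ[Qᵐᵒᵖ] X) (hf : Function.Surjective f)
    (hdim : Module.finrank Δ (X →ₗ[Qᵐᵒᵖ] S) = n * Module.finrank Δ S)
    {q : Fin n → Qᵐᵒᵖ} (hq : f q = 0) (h : H) (t : Fin n) (s : S) :
    MulOpposite.op (h • MulOpposite.unop (q t)) • s = 0 := by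
  have hXfin : Module.Finite Qᵐᵒᵖ X := Module.Finite.of_surjective f hf
  have hHom : Module.Finite Δ (X →ₗ[Qᵐᵒᵖ] S) := module_finite_linearMap
  let P : Submodule k H := LinearMap.ker (((LinearMap.toSpanSingleton Qᵐᵒᵖ S s).restrictScalars k
    ∘ₗ (MulOpposite.opLinearEquiv k (M := Q)).toLinearMap) ∘ₗ
      hopfOrbitMap k H (MulOpposite.unop (q t)))
  refine mem_of_forall_isMultiplicativeMatrix P (fun d C hC i₀ j₀ => ?_) h
  change MulOpposite.op (C i₀ j₀ • MulOpposite.unop (q t)) • s = 0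
  let e : Fin n → X := fun t => f (Pi.single t 1)
  have hfe : ∀ q : Fin n → Qᵐᵒᵖ, f q = ∑ t, q t • e t := fun q => by
    simp only [e, ← map_smul, ← map_sum]
    congr 1
    funext t
    simp [Finset.sum_apply, Pi.single_apply]
  let Θ : (Fin d → X →ₗ[Qᵐᵒᵖ] S) →ₗ[Δ] (Fin n → Fin d → S) :=
    { toFun := fun ψ t j => ∑ i, ψ i (C i j • e t)
      map_add' := fun ψ χ => by
        funext t j
        simp [Finset.sum_add_distrib]
      map_smul' := fun c ψ => by
        funext t j
        simp [Finset.smul_sum] }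
  have hΘ : ∀ ψ j (q : Fin n → Qᵐᵒᵖ), ∑ i, ψ i (C i j • f q) =
      ∑ t, ∑ l, MulOpposite.op (C l j • MulOpposite.unop (q t)) • Θ ψ t l := by
    intro ψ j q
    simp only [hfe, Finset.smul_sum, map_sum, hX d C hC, map_smul, Θ, LinearMap.coe_mk,
      AddHom.coe_mk]
    rw [Finset.sum_comm]
    exact Finset.sum_congr rfl fun t _ => Finset.sum_comm
  -- `Θ` is injective as `C` is invertible, so it is onto by equality of dimensions
  have hinj : Function.Injective Θ := by
    rw [injective_iff_map_eq_zero]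
    intro ψ hψ
    have h0 : ∀ j (x : X), ∑ i, ψ i (C i j • x) = 0 := by
      intro j x
      obtain ⟨q, rfl⟩ := hf x
      rw [hΘ, hψ]
      simp
    funext p
    refine LinearMap.ext fun y => ?_
    have h1 : ∑ j, ∑ i, ψ i (C i j • HopfAlgebra.antipode k (C j p) • y) = 0 :=
      Finset.sum_eq_zero fun j _ => h0 j _
    rw [Finset.sum_comm] at h1
    simp only [← map_sum, hC.sum_smul_antipode] at h1
    simpa [apply_ite, Finset.sum_ite_eq'] using h1
  have hrank : Module.finrank Δ (Fin d → X →ₗ[Qᵐᵒᵖ] S) =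
      Module.finrank Δ (Fin n → Fin d → S) := by
    rw [Module.finrank_pi_fintype, Module.finrank_pi_fintype]
    simp only [Module.finrank_pi_fintype, Finset.sum_const, Finset.card_univ, Fintype.card_fin,
      smul_eq_mul, hdim]
    ring
  obtain ⟨ψ, hψ⟩ := (LinearMap.injective_iff_surjective_of_finrank_eq_finrank hrank).mp hinj
    (Pi.single t (Pi.single i₀ s))
  have h1 := hΘ ψ j₀ q
  rw [hq, hψ] at h1
  simp only [smul_zero, map_zero, Finset.sum_const_zero] at h1
  rw [Finset.sum_eq_single t (fun t' _ ht' => by simp [ht']) (by simp),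
    Finset.sum_eq_single i₀ (fun l _ hl => by simp [hl]) (by simp)] at h1
  simpa using h1.symm

end Invariance

/-! ### Opposite rings and isomorphic simple modules -/

section Opposite

theorem exists_opposite_ideal {R : Type*} [Ring R] (J : Ideal R) [J.IsTwoSided]
    [IsSemisimpleRing (R ⧸ J)] {N : ℕ} (hJ : J ^ N = ⊥) :
    ∃ (J' : Ideal Rᵐᵒᵖ) (_ : J'.IsTwoSided), IsSemisimpleRing (Rᵐᵒᵖ ⧸ J') ∧ J' ^ N = ⊥ := by
  let φ : Rᵐᵒᵖ →+* (R ⧸ J)ᵐᵒᵖ := (Ideal.Quotient.mk J).op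
  have hφ : Function.Surjective φ := fun x => by
    obtain ⟨y, hy⟩ := Ideal.Quotient.mk_surjective x.unop
    exact ⟨MulOpposite.op y, MulOpposite.unop_injective hy⟩
  have hmem : ∀ x, x ∈ RingHom.ker φ ↔ x.unop ∈ J := fun x => by
    rw [RingHom.mem_ker, ← Ideal.Quotient.eq_zero_iff_mem, ← MulOpposite.unop_eq_zero_iff]
    rfl
  refine ⟨RingHom.ker φ, inferInstance, ?_, ?_⟩
  · exact (RingHom.quotientKerEquivOfSurjective hφ).symm.isSemisimpleRing
  · have key : ∀ n : ℕ, ∀ x ∈ RingHom.ker φ ^ n, x.unop ∈ J ^ n := by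
      intro n
      induction n with
      | zero => intro x _; simp [Submodule.pow_zero, Ideal.one_eq_top]
      | succ n ih =>
        intro x hx
        rw [Submodule.pow_succ] at hx
        rw [Ideal.IsTwoSided.pow_succ]
        induction hx using Submodule.mul_induction_on' with
        | mem_mul_mem a ha b hb =>
          exact Submodule.mul_mem_mul ((hmem b).mp hb) (ih a ha)
        | add a _ b _ ha hb => exact add_mem ha hb
    rw [eq_bot_iff]
    intro x hx
    have := key N x hx
    rw [hJ] at this
    exact MulOpposite.unop_injective this

variable {R : Type*} [Ring R]

theorem finrank_linearMap_end_eq_of_equiv (X : Type*) {S S' : Type*} [AddCommGroup X] [Module R X]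
    [AddCommGroup S] [Module R S] [AddCommGroup S'] [Module R S'] (e : S ≃ₗ[R] S') :
    Module.finrank (Module.End R S) (X →ₗ[R] S) =
      Module.finrank (Module.End R S') (X →ₗ[R] S') := by
  let j : (X →ₗ[R] S) ≃+ (X →ₗ[R] S') :=
    { toFun := fun φ => e.toLinearMap ∘ₗ φ
      invFun := fun φ => e.symm.toLinearMap ∘ₗ φ
      left_inv := fun φ => by ext; simp
      right_inv := fun φ => by ext; simp
      map_add' := fun φ ψ => by ext; simp }
  have h := lift_rank_eq_of_equiv_equiv (e.conjRingEquiv : Module.End R S → Module.End R S') j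
    e.conjRingEquiv.bijective fun c φ => by
      ext x
      change e (c (φ x)) = e (c (e.symm (e (φ x))))
      simp
  simpa [Module.finrank] using congrArg Cardinal.toNat h

theorem finrank_end_eq_of_equiv {S S' : Type*} [AddCommGroup S] [Module R S] [AddCommGroup S']
    [Module R S'] (e : S ≃ₗ[R] S') :
    Module.finrank (Module.End R S) S = Module.finrank (Module.End R S') S' := by
  have h := lift_rank_eq_of_equiv_equiv (e.conjRingEquiv : Module.End R S → Module.End R S')
    e.toAddEquiv e.conjRingEquiv.bijective fun c x => by
      change e (c x) = e (c (e.symm (e x)))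
      simp
  simpa [Module.finrank] using congrArg Cardinal.toNat h

end Opposite

/-! ### The filter of dense subspaces -/

section DenseFilter

variable (k : Type*) {H Q : Type*} [Field k] [Ring H] [HopfAlgebra k H] [Ring Q] [Algebra k Q]
  [Module H Q] [IsScalarTower k H Q]

/-- The subspaces of `Q` containing a member of a Gabriel topology `G` on the subalgebra `A`. -/
def denseFilter (A : Subalgebra k Q) (G : Set (RightIdeal A)) : Set (Submodule k Q) :=
  {W | ∃ I ∈ G, ∀ x ∈ I, (x : Q) ∈ W}

/-- The properties of the family `O` of subspaces of `Q` containing a member of the Gabriel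
topology that enter the argument. -/
structure IsDenseFilter (H : Type*) [Ring H] [HopfAlgebra k H] [Module H Q] [IsScalarTower k H Q]
    (A : Subalgebra k Q) (O : Set (Submodule k Q)) : Prop where
  mono : ∀ {V W : Submodule k Q}, V ∈ O → V ≤ W → W ∈ O
  inf_mem : ∀ {V W : Submodule k Q}, V ∈ O → W ∈ O → V ⊓ W ∈ O
  mul_mem : ∀ {V W : Submodule k Q}, V ∈ O → W ∈ O → V * W ∈ O
  toSubmodule_mem : Subalgebra.toSubmodule A ∈ O
  comap_mulLeft_mem : ∀ {W : Submodule k Q}, W ∈ O → ∀ q : Q, W.comap (LinearMap.mulLeft k q) ∈ O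
  comap_antipode_mem : ∀ {W : Submodule k Q}, W ∈ O → ∀ h : H,
    W.comap (DistribSMul.toLinearMap k Q (HopfAlgebra.antipode k h)) ∈ O
  eq_zero_of_mul_eq_zero : ∀ {W : Submodule k Q}, W ∈ O → ∀ q : Q, (∀ w ∈ W, q * w = 0) → q = 0
  eq_zero_of_mul_eq_zero' : ∀ {W : Submodule k Q}, W ∈ O → ∀ q : Q, (∀ w ∈ W, w * q = 0) → q = 0

theorem exists_coset_subset_of_isOpen {R : Type*} [Ring R] {G : Set (RightIdeal R)}
    (hG : IsRightGabrielTopology G) (hne : G.Nonempty) {U : Set R}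
    (hU : @IsOpen R (rightIdealTopology G) U) {x : R} (hx : x ∈ U) :
    ∃ I ∈ G, ∀ y, y - x ∈ I → y ∈ U := by
  induction hU with
  | basic U hU =>
    obtain ⟨z, I, hI, rfl⟩ := hU
    refine ⟨I, hI, fun y hy => ?_⟩
    have : (y - x) + (x - z) ∈ I := I.add_mem hy hx
    simpa using this
  | univ => exact hne.imp fun I hI => ⟨hI, fun y _ => trivial⟩
  | inter U V _ _ h₁ h₂ =>
    obtain ⟨I, hI, h₁⟩ := h₁ hx.1
    obtain ⟨I', hI', h₂⟩ := h₂ hx.2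
    exact ⟨I ⊓ I', hG.inf_mem I I' hI hI', fun y hy => ⟨h₁ y hy.1, h₂ y hy.2⟩⟩
  | sUnion T _ h =>
    obtain ⟨U, hU, hxU⟩ := hx
    obtain ⟨I, hI, h'⟩ := h U hU hxU
    exact ⟨I, hI, fun y hy => ⟨U, hU, h' y hy⟩⟩

theorem isDenseFilter_denseFilter (A : Subalgebra k Q) (hstable : ∀ (h : H), ∀ a ∈ A, h • a ∈ A)
    (G : Set (RightIdeal A)) (hG : IsRightGabrielTopology G)
    (hcont : ∀ (h : H), h ∈ LinearMap.range (HopfAlgebra.antipode k (A := H)) →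
      IsGabrielContinuous G (fun a : A => ⟨h • (a : Q), hstable h a a.2⟩))
    (hlann : ∀ I ∈ G, ∀ q : Q, (∀ x ∈ I, q * (x : Q) = 0) → q = 0)
    (hrann : ∀ I ∈ G, ∀ a : A, (∀ x ∈ I, x * a = 0) → a = 0)
    (hfrac : ∀ q : Q, ∃ I ∈ G, ∀ x ∈ I, q * (x : Q) ∈ A) :
    IsDenseFilter k H A (denseFilter k A G) := by
  have hne : G.Nonempty := (hfrac 0).imp fun I hI => hI.1
  refine ⟨?_, ?_, ?_, ?_, ?_, ?_, ?_, ?_⟩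
  · rintro V W ⟨I, hI, h⟩ hVW
    exact ⟨I, hI, fun x hx => hVW (h x hx)⟩
  · rintro V W ⟨I, hI, h⟩ ⟨I', hI', h'⟩
    exact ⟨I ⊓ I', hG.inf_mem I I' hI hI', fun x hx => ⟨h x hx.1, h' x hx.2⟩⟩
  · rintro V W ⟨I, hI, h⟩ ⟨I', hI', h'⟩
    let K : RightIdeal A := Submodule.span Aᵐᵒᵖ {z | ∃ x ∈ I, ∃ y ∈ I', z = x * y}
    refine ⟨K, hG.mem_of_quotBy_mem K I hI fun x hx =>
      hG.mem_of_le _ I' hI' fun y hy => Submodule.subset_span ⟨x, hx, y, hy, rfl⟩, ?_⟩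
    intro z hz
    have key : ∀ a : A, ((z * a : A) : Q) ∈ V * W := by
      induction hz using Submodule.span_induction with
      | mem z hz =>
        obtain ⟨x, hx, y, hy, rfl⟩ := hz
        intro a
        rw [mul_assoc]
        exact Submodule.mul_mem_mul (h x hx) (h' _ (I'.smul_mem (MulOpposite.op a) hy))
      | zero => intro a; rw [zero_mul]; exact Submodule.zero_mem _
      | add x y _ _ h₁ h₂ => intro a; rw [add_mul]; exact Submodule.add_mem _ (h₁ a) (h₂ a)
      | smul b x _ h₁ =>
        intro a
        have := h₁ (b.unop * a)
        rw [← mul_assoc] at this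
        exact this
    simpa using key 1
  · exact hne.imp fun I hI => ⟨hI, fun x _ => x.2⟩
  · rintro W ⟨I, hI, h⟩ q
    obtain ⟨L, hL, hqL⟩ := hfrac q
    let K : RightIdeal A :=
      { carrier := {x | ∃ y ∈ I, q * (x : Q) = y}
        add_mem' := by
          rintro a b ⟨y, hy, h₁⟩ ⟨z, hz, h₂⟩
          exact ⟨y + z, I.add_mem hy hz, by simp [mul_add, h₁, h₂]⟩
        zero_mem' := ⟨0, I.zero_mem, by simp⟩
        smul_mem' := by
          rintro c a ⟨y, hy, h₁⟩
          refine ⟨c • y, I.smul_mem c hy, ?_⟩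
          change q * ((a : Q) * (c.unop : Q)) = (y : Q) * (c.unop : Q)
          rw [← h₁, mul_assoc] }
    refine ⟨K, hG.mem_of_quotBy_mem K L hL fun a ha => ?_, ?_⟩
    · refine hG.mem_of_le _ _ (hG.quotBy_mem I hI ⟨q * a, hqL a ha⟩) fun x hx => ?_
      exact ⟨_, hx, by simp [mul_assoc]⟩
    · rintro x ⟨y, hy, h₁⟩
      change q * (x : Q) ∈ W
      rw [h₁]
      exact h y hy
  · rintro W ⟨I, hI, h⟩ g
    have hc := hcont _ ⟨g, rfl⟩
    have hop : @IsOpen A (rightIdealTopology G) {y : A | y - 0 ∈ I} :=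
      TopologicalSpace.GenerateOpen.basic _ ⟨0, I, hI, rfl⟩
    have hop' := @IsOpen.preimage A A (rightIdealTopology G) (rightIdealTopology G) _ hc _ hop
    obtain ⟨L, hL, hL'⟩ := exists_coset_subset_of_isOpen hG hne hop' (x := 0) (by
      change (⟨_ • ((0 : A) : Q), _⟩ : A) - 0 ∈ I
      convert I.zero_mem using 1
      ext
      simp)
    refine ⟨L, hL, fun x hx => ?_⟩
    have h1 := hL' x (by simpa using hx)
    rw [Set.mem_preimage, Set.mem_ofPred_eq, sub_zero] at h1
    exact h _ h1
  · rintro W ⟨I, hI, h⟩ q hq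
    exact hlann I hI q fun x hx => hq x (h x hx)
  · rintro W ⟨I, hI, h⟩ q hq
    obtain ⟨L, hL, hqL⟩ := hfrac q
    refine hlann L hL q fun y hy => ?_
    have := hrann I hI ⟨q * y, hqL y hy⟩ fun x hx => by
      ext
      simp [← mul_assoc, hq x (h x hx)]
    exact congrArg Subtype.val this

end DenseFilter

/-! ### Complements of stable ideals -/

section StableIdeal

variable {k H Q : Type*} [Field k] [Ring H] [Ring Q] [Algebra k Q] [Module H Q]

/-- The subspace `X` of the `k`-algebra `Q` is a two-sided ideal. -/
structure IsTwoSidedSubspace (X : Submodule k Q) : Prop where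
  mul_mem_left : ∀ (q : Q) {x : Q}, x ∈ X → q * x ∈ X
  mul_mem_right : ∀ (q : Q) {x : Q}, x ∈ X → x * q ∈ X

/-- The subspace `X` is stable under the action of `H`. -/
def IsHopfStable (H : Type*) [Ring H] [Module H Q] (X : Submodule k Q) : Prop :=
  ∀ h : H, ∀ x ∈ X, h • x ∈ X

theorem IsTwoSidedSubspace.inf {X Y : Submodule k Q} (hX : IsTwoSidedSubspace X)
    (hY : IsTwoSidedSubspace Y) : IsTwoSidedSubspace (X ⊓ Y) :=
  ⟨fun q _ hx => ⟨hX.mul_mem_left q hx.1, hY.mul_mem_left q hx.2⟩,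
    fun q _ hx => ⟨hX.mul_mem_right q hx.1, hY.mul_mem_right q hx.2⟩⟩

theorem IsHopfStable.inf {X Y : Submodule k Q} (hX : IsHopfStable H X) (hY : IsHopfStable H Y) :
    IsHopfStable H (X ⊓ Y) :=
  fun h _ hx => ⟨hX h _ hx.1, hY h _ hx.2⟩

theorem IsHopfSemiprime.eq_bot_of_mul_eq_zero (hsp : IsHopfSemiprime H Q) {Y : Submodule k Q}
    (hY : IsTwoSidedSubspace Y) (hYH : IsHopfStable H Y) (h : ∀ x ∈ Y, ∀ y ∈ Y, x * y = 0) :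
    Y = ⊥ := by
  let I : Ideal Q :=
    { carrier := Y
      add_mem' := Y.add_mem
      zero_mem' := Y.zero_mem
      smul_mem' := fun q _ hx => hY.mul_mem_left q hx }
  have hI : I = ⊥ := by
    refine hsp I ⟨fun q hx => hY.mul_mem_right q hx⟩ hYH ⟨2, ?_⟩
    rw [Submodule.pow_succ, Submodule.pow_one]
    refine eq_bot_iff.mpr (Ideal.mul_le.mpr fun x hx y hy => ?_)
    exact h x hx y hy
  refine eq_bot_iff.mpr fun x hx => ?_
  have : x ∈ I := hx
  rw [hI] at this
  exact this

/-- The left annihilator of `X`. -/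
def leftAnnihilator (X : Submodule k Q) : Submodule k Q where
  carrier := {q | ∀ x ∈ X, q * x = 0}
  add_mem' ha hb x hx := by rw [add_mul, ha x hx, hb x hx, add_zero]
  zero_mem' x _ := zero_mul x
  smul_mem' c q hq x hx := by rw [smul_mul_assoc, hq x hx, smul_zero]

theorem isTwoSidedSubspace_leftAnnihilator {X : Submodule k Q} (hX : IsTwoSidedSubspace X) :
    IsTwoSidedSubspace (leftAnnihilator X) :=
  ⟨fun q z hz x hx => by rw [mul_assoc, hz x hx, mul_zero],
    fun q z hz x hx => by rw [mul_assoc]; exact hz _ (hX.mul_mem_left q hx)⟩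

variable [HopfAlgebra k H] [IsScalarTower k H Q]

theorem smul_mul_mem (hQ : IsHopfModuleAlgebra k H Q) (X : Submodule k Q) (a b : Q)
    (hX : ∀ g g' : H, (g • a) * (g' • b) ∈ X) (h : H) : h • (a * b) ∈ X := by
  rw [hQ.smul_mul]
  generalize Coalgebra.comul (R := k) h = t
  induction t with
  | zero => rw [map_zero, map_zero]; exact X.zero_mem
  | add t₁ t₂ h₁ h₂ => rw [map_add, map_add]; exact X.add_mem h₁ h₂
  | tmul g g' => exact hX g g'

theorem smul_mem_of_isMultiplicativeMatrix (X : Submodule k Q) (q : Q)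
    (hX : ∀ (d : ℕ) (C : Fin d → Fin d → H), IsMultiplicativeMatrix k C → ∀ i j, C i j • q ∈ X)
    (h : H) : h • q ∈ X :=
  mem_of_forall_isMultiplicativeMatrix (X.comap (hopfOrbitMap k H q)) hX h

theorem IsHopfStable.mul (hQ : IsHopfModuleAlgebra k H Q) {X Y : Submodule k Q}
    (hX : IsHopfStable H X) (hY : IsHopfStable H Y) : IsHopfStable H (X * Y) := by
  intro h x hx
  induction hx using Submodule.mul_induction_on' with
  | mem_mul_mem a ha b hb =>
    exact smul_mul_mem hQ _ a b (fun g g' => Submodule.mul_mem_mul (hX g a ha) (hY g' b hb)) h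
  | add a _ b _ ha hb => rw [smul_add]; exact add_mem ha hb

theorem isHopfStable_leftAnnihilator (hQ : IsHopfModuleAlgebra k H Q) {X : Submodule k Q}
    (hX : IsHopfStable H X) : IsHopfStable H (leftAnnihilator X) := by
  intro h z hz
  refine smul_mem_of_isMultiplicativeMatrix (leftAnnihilator X) z (fun d C hC i j => ?_) h
  intro x hx
  rw [hC.smul_mul_eq_sum hQ]
  exact Finset.sum_eq_zero fun l _ => by rw [hz _ (hX _ x hx), smul_zero]

variable {A : Subalgebra k Q} {O : Set (Submodule k Q)}

theorem mul_eq_zero_of_mul_inf_eq_zero (hO : IsDenseFilter k H A O) {E : Submodule k Q}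
    (hE : IsTwoSidedSubspace E) {z : Q} (hz : ∀ x ∈ E ⊓ Subalgebra.toSubmodule A, z * x = 0)
    {x : Q} (hx : x ∈ E) : z * x = 0 := by
  refine hO.eq_zero_of_mul_eq_zero (hO.comap_mulLeft_mem hO.toSubmodule_mem x) _ fun a ha => ?_
  rw [mul_assoc]
  exact hz _ ⟨hE.mul_mem_right a hx, ha⟩

/-- A stable ideal whose intersection with `A` is nilpotent is zero. -/
theorem eq_bot_of_inf_pow_eq_bot (hQ : IsHopfModuleAlgebra k H Q) (hsp : IsHopfSemiprime H Q)
    (hO : IsDenseFilter k H A O) {E : Submodule k Q} (hE : IsTwoSidedSubspace E)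
    (hEH : IsHopfStable H E) (m : ℕ) (hm : (E ⊓ Subalgebra.toSubmodule A) ^ (m + 1) = ⊥) :
    E = ⊥ := by
  set B := E ⊓ Subalgebra.toSubmodule A with hB
  -- its square is zero
  have hdisj : E ⊓ leftAnnihilator E = ⊥ := by
    refine hsp.eq_bot_of_mul_eq_zero (hE.inf (isTwoSidedSubspace_leftAnnihilator hE))
      (hEH.inf (isHopfStable_leftAnnihilator hQ hEH)) fun x hx y hy => hx.2 y hy.1
  have hBE : ∀ j, B ^ (j + 1) ≤ E := by
    intro j
    rw [pow_succ]
    refine Submodule.mul_le.mpr fun x _ y hy => hE.mul_mem_left x hy.1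
  induction m with
  | zero =>
    rw [zero_add, pow_one] at hm
    refine eq_bot_iff.mpr fun x hx => ?_
    rw [← hdisj]
    refine ⟨hx, fun y hy => mul_eq_zero_of_mul_inf_eq_zero hO hE (fun b hb => ?_) hy⟩
    have : b ∈ B := hb
    rw [hm] at this
    rw [(Submodule.mem_bot k).mp this, mul_zero]
  | succ m ih =>
    refine ih (eq_bot_iff.mpr fun x hx => ?_)
    rw [← hdisj]
    refine ⟨hBE m hx, fun y hy => mul_eq_zero_of_mul_inf_eq_zero hO hE (fun b hb => ?_) hy⟩
    have : x * b ∈ B ^ (m + 1 + 1) := by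
      rw [pow_succ]
      exact Submodule.mul_mem_mul hx hb
    rw [hm] at this
    exact this

/-- A right ideal of the right Noetherian ring `A` generates a finitely generated right ideal. -/
theorem span_op_fg (hnoeth : IsNoetherian Aᵐᵒᵖ A) {W : Submodule k Q}
    (hW : W ≤ Subalgebra.toSubmodule A) (hWA : ∀ w ∈ W, ∀ a ∈ A, w * a ∈ W) :
    (Submodule.span Qᵐᵒᵖ (W : Set Q)).FG := by
  classical
  let I : RightIdeal A :=
    { carrier := {a | (a : Q) ∈ W}
      add_mem' := fun ha hb => W.add_mem ha hb
      zero_mem' := W.zero_mem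
      smul_mem' := fun c a ha => hWA a ha c.unop c.unop.2 }
  obtain ⟨s, hs⟩ := hnoeth.noetherian I
  refine ⟨s.image (fun a : A => (a : Q)), le_antisymm (Submodule.span_mono ?_)
    (Submodule.span_le.mpr ?_)⟩
  · intro x hx
    obtain ⟨a, ha, rfl⟩ := Finset.mem_image.mp (Finset.mem_coe.mp hx)
    have : a ∈ I := hs ▸ Submodule.subset_span ha
    exact this
  · intro w hw
    have h1 : (⟨w, hW hw⟩ : A) ∈ Submodule.span Aᵐᵒᵖ (s : Set A) := by
      rw [hs]; exact hw
    have h2 : ∀ a ∈ Submodule.span Aᵐᵒᵖ (s : Set A), (a : Q) ∈ Submodule.span Qᵐᵒᵖ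
        ((s.image (fun a : A => (a : Q)) : Finset Q) : Set Q) := by
      intro a ha
      induction ha using Submodule.span_induction with
      | mem a ha => exact Submodule.subset_span (Finset.mem_coe.mpr (Finset.mem_image_of_mem _ ha))
      | zero => exact Submodule.zero_mem _
      | add a b _ _ h₁ h₂ => exact Submodule.add_mem _ h₁ h₂
      | smul c a _ h₁ => exact Submodule.smul_mem _ (MulOpposite.op (c.unop : Q)) h₁
    exact h2 _ h1

theorem smul_mem_span_op (hQ : IsHopfModuleAlgebra k H Q) {W : Submodule k Q}
    (hW : IsHopfStable H W) (h : H) {x : Q} (hx : x ∈ Submodule.span Qᵐᵒᵖ (W : Set Q)) :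
    h • x ∈ Submodule.span Qᵐᵒᵖ (W : Set Q) := by
  induction hx using Submodule.span_induction generalizing h with
  | mem x hx => exact Submodule.subset_span (hW h x hx)
  | zero => rw [smul_zero]; exact Submodule.zero_mem _
  | add a b _ _ h₁ h₂ => rw [smul_add]; exact Submodule.add_mem _ (h₁ h) (h₂ h)
  | smul c x _ ih =>
    exact smul_mul_mem hQ ((Submodule.span Qᵐᵒᵖ (W : Set Q)).restrictScalars k) x c.unop
      (fun g g' => Submodule.smul_mem _ (MulOpposite.op (g' • c.unop)) (ih g)) h

end StableIdeal

/-! ### Stable cores and comaximal stable ideals -/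

section Core

variable {k H Q : Type*} [Field k] [Ring H] [HopfAlgebra k H] [Ring Q] [Algebra k Q]
  [Module H Q] [IsScalarTower k H Q]

/-- The largest `H`-stable subspace of `P`. -/
def hopfCore (H : Type*) [Ring H] [HopfAlgebra k H] [Module H Q] [IsScalarTower k H Q]
    (P : Submodule k Q) : Submodule k Q where
  carrier := {q | ∀ h : H, h • q ∈ P}
  add_mem' ha hb h := by rw [smul_add]; exact P.add_mem (ha h) (hb h)
  zero_mem' h := by rw [smul_zero]; exact P.zero_mem
  smul_mem' c q hq h := by rw [smul_algebra_smul_comm]; exact P.smul_mem c (hq h)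

theorem hopfCore_le (P : Submodule k Q) : hopfCore H P ≤ P := fun q hq => by
  simpa using hq 1

theorem isHopfStable_hopfCore (P : Submodule k Q) : IsHopfStable H (hopfCore H P) :=
  fun h q hq g => by rw [smul_smul]; exact hq (g * h)

theorem le_hopfCore {V P : Submodule k Q} (hV : IsHopfStable H V) (hVP : V ≤ P) :
    V ≤ hopfCore H P :=
  fun _ hx h => hVP (hV h _ hx)

theorem isTwoSidedSubspace_hopfCore (hQ : IsHopfModuleAlgebra k H Q) {P : Submodule k Q}
    (hP : IsTwoSidedSubspace P) : IsTwoSidedSubspace (hopfCore H P) :=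
  ⟨fun _ _ hx h => smul_mul_mem hQ P _ _ (fun _ g' => hP.mul_mem_left _ (hx g')) h,
    fun _ _ hx h => smul_mul_mem hQ P _ _ (fun g _ => hP.mul_mem_right _ (hx g)) h⟩

variable (k) in
/-- The annihilator in `Q` of a right `Q`-module. -/
def rightModuleAnnihilator (S : Type*) [AddCommGroup S] [Module Qᵐᵒᵖ S] [Module k S]
    [IsScalarTower k Qᵐᵒᵖ S] : Submodule k Q where
  carrier := {q | ∀ s : S, MulOpposite.op q • s = 0}
  add_mem' ha hb s := by rw [MulOpposite.op_add, add_smul, ha s, hb s, add_zero]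
  zero_mem' s := by rw [MulOpposite.op_zero, zero_smul]
  smul_mem' c q hq s := by rw [MulOpposite.op_smul, smul_assoc, hq s, smul_zero]

theorem isTwoSidedSubspace_rightModuleAnnihilator (S : Type*) [AddCommGroup S] [Module Qᵐᵒᵖ S]
    [Module k S] [IsScalarTower k Qᵐᵒᵖ S] :
    IsTwoSidedSubspace (rightModuleAnnihilator k (Q := Q) S) :=
  ⟨fun q x hx s => by rw [MulOpposite.op_mul, mul_smul, hx],
    fun q x hx s => by rw [MulOpposite.op_mul, mul_smul, hx s, smul_zero]⟩

variable {A : Subalgebra k Q} {O : Set (Submodule k Q)}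

/-- The inductive step in the construction of complements of stable ideals: for a nonzero stable
ideal `E` there are a simple right module not killed by `E` and a stable ideal that kills it and is
comaximal with `E`. -/
theorem exists_comaximal_hopfIdeal (J : Ideal Qᵐᵒᵖ) [J.IsTwoSided] [IsSemisimpleRing (Qᵐᵒᵖ ⧸ J)]
    {N : ℕ} (hJ : J ^ N = ⊥) (hQ : IsHopfModuleAlgebra k H Q) (hsp : IsHopfSemiprime H Q)
    (hnoeth : IsNoetherian Aᵐᵒᵖ A) (hstable : ∀ (h : H), ∀ a ∈ A, h • a ∈ A)
    (hO : IsDenseFilter k H A O) {t : ℕ} (𝔪 : Fin t → Ideal Qᵐᵒᵖ) (h𝔪 : ∀ i, (𝔪 i).IsMaximal)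
    (hiso : ∀ 𝔫 : Ideal Qᵐᵒᵖ, 𝔫.IsMaximal → ∃ i, Nonempty ((Qᵐᵒᵖ ⧸ 𝔫) ≃ₗ[Qᵐᵒᵖ] (Qᵐᵒᵖ ⧸ 𝔪 i)))
    {E : Submodule k Q} (hE : IsTwoSidedSubspace E) (hEH : IsHopfStable H E) (hE0 : E ≠ ⊥) :
    ∃ (j : Fin t) (X : Submodule k Q), IsTwoSidedSubspace X ∧ IsHopfStable H X ∧ X ⊔ E = ⊤ ∧
      X ≤ rightModuleAnnihilator k (Qᵐᵒᵖ ⧸ 𝔪 j) ∧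
      ¬ E ≤ rightModuleAnnihilator k (Qᵐᵒᵖ ⧸ 𝔪 j) := by
  classical
  set B := E ⊓ Subalgebra.toSubmodule A with hB
  have hBB : B * B ≤ B := Submodule.mul_le.mpr fun x hx y hy =>
    ⟨hE.mul_mem_left x hy.1, A.mul_mem hx.2 hy.2⟩
  have hBH : IsHopfStable H B := hEH.inf hstable
  have hBanti : Antitone fun m => B ^ (m + 1) := antitone_nat_of_succ_le fun m => by
    calc B ^ (m + 1 + 1) = B ^ m * (B * B) := by rw [pow_succ, pow_succ, mul_assoc]
      _ ≤ B ^ m * B := by gcongr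
      _ = B ^ (m + 1) := (pow_succ _ _).symm
  have hBpow : ∀ m, IsHopfStable H (B ^ (m + 1)) := by
    intro m
    induction m with
    | zero => simpa using hBH
    | succ m ih => rw [pow_succ]; exact ih.mul hQ hBH
  have hBA : ∀ m, ∀ w ∈ B ^ (m + 1), ∀ a ∈ A, w * a ∈ B ^ (m + 1) := by
    intro m w hw a ha
    rw [pow_succ] at hw ⊢
    induction hw using Submodule.mul_induction_on' with
    | mem_mul_mem x hx b hb =>
      rw [mul_assoc]
      exact Submodule.mul_mem_mul hx ⟨hE.mul_mem_right a hb.1, A.mul_mem hb.2 ha⟩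
    | add x _ y _ hx hy => rw [add_mul]; exact add_mem hx hy
  have hBle : ∀ m, B ^ (m + 1) ≤ Subalgebra.toSubmodule A := fun m => by
    have := hBanti (Nat.zero_le m)
    simp only [zero_add, pow_one] at this
    exact this.trans inf_le_right
  let Ms : ℕ → Submodule Qᵐᵒᵖ Q := fun m =>
    Submodule.span Qᵐᵒᵖ ((B ^ (m + 1) : Submodule k Q) : Set Q)
  obtain ⟨m, hm⟩ := exists_stable_of_antitone_fg J hJ Ms
    (fun a b hab => Submodule.span_mono (hBanti hab)) fun m => span_op_fg hnoeth (hBle m) (hBA m)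
  set M := Ms m with hM
  have hM1 : Ms (m + 1) = M := hm (m + 1) (Nat.le_succ m)
  have hMfin : Module.Finite Qᵐᵒᵖ M := Module.Finite.iff_fg.mpr (span_op_fg hnoeth (hBle m) (hBA m))
  have hMH : ∀ (h : H), ∀ x ∈ M, h • x ∈ M := fun h x hx => smul_mem_span_op hQ (hBpow m) h hx
  have hM0 : M ≠ ⊥ := fun h0 => hE0 (eq_bot_of_inf_pow_eq_bot hQ hsp hO hE hEH m
    (eq_bot_iff.mpr fun x hx => by
      have : x ∈ M := Submodule.subset_span hx
      rw [h0] at this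
      exact this))
  -- maps from `M = M E` to a module killed by `E` vanish
  have hzero : ∀ 𝔫 : Ideal Qᵐᵒᵖ, E ≤ rightModuleAnnihilator k (Qᵐᵒᵖ ⧸ 𝔫) →
      ∀ φ : M →ₗ[Qᵐᵒᵖ] (Qᵐᵒᵖ ⧸ 𝔫), φ = 0 := by
    intro 𝔫 h𝔫 φ
    have hle : Ms (m + 1) ≤ (LinearMap.ker φ).map M.subtype := by
      refine Submodule.span_le.mpr fun x hx => ?_
      change x ∈ B ^ (m + 1 + 1) at hx
      rw [pow_succ] at hx
      change x ∈ (LinearMap.ker φ).map M.subtype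
      induction hx using Submodule.mul_induction_on' with
      | mem_mul_mem a ha b hb =>
        have haM : a ∈ M := Submodule.subset_span ha
        refine ⟨MulOpposite.op b • ⟨a, haM⟩, ?_, rfl⟩
        change φ _ = 0
        rw [map_smul]
        exact h𝔫 hb.1 _
      | add a _ b _ ha hb => exact add_mem ha hb
    refine LinearMap.ext fun x => ?_
    obtain ⟨y, hy, hyx⟩ := hle (hM1.symm.le x.2)
    have : y = x := Subtype.ext hyx
    rw [← this]
    exact hy
  have hsimple : ∀ i, IsSimpleModule Qᵐᵒᵖ (Qᵐᵒᵖ ⧸ 𝔪 i) := fun i =>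
    isSimpleModule_iff_isCoatom.mpr (h𝔪 i).1
  have hfinS : ∀ i, Module.Finite (Module.End Qᵐᵒᵖ (Qᵐᵒᵖ ⧸ 𝔪 i)) (Qᵐᵒᵖ ⧸ 𝔪 i) := fun i =>
    module_finite_end_of_isSimpleModule J hJ _
  have hfinHom : ∀ i, Module.Finite (Module.End Qᵐᵒᵖ (Qᵐᵒᵖ ⧸ 𝔪 i)) (M →ₗ[Qᵐᵒᵖ] (Qᵐᵒᵖ ⧸ 𝔪 i)) :=
    fun i => module_finite_linearMap
  let r : Fin t → ℕ := fun i =>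
    Module.finrank (Module.End Qᵐᵒᵖ (Qᵐᵒᵖ ⧸ 𝔪 i)) (M →ₗ[Qᵐᵒᵖ] (Qᵐᵒᵖ ⧸ 𝔪 i))
  let n : Fin t → ℕ := fun i => Module.finrank (Module.End Qᵐᵒᵖ (Qᵐᵒᵖ ⧸ 𝔪 i)) (Qᵐᵒᵖ ⧸ 𝔪 i)
  have hn : ∀ i, 0 < n i := fun i => by
    have := IsSimpleModule.nontrivial Qᵐᵒᵖ (Qᵐᵒᵖ ⧸ 𝔪 i)
    exact Module.finrank_pos
  have hr : ∃ i, 0 < r i := by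
    have : Nontrivial M := Submodule.nontrivial_iff_ne_bot.mpr hM0
    obtain ⟨K, hK, -⟩ := (eq_top_or_exists_le_coatom (⊥ : Submodule Qᵐᵒᵖ M)).resolve_left
      bot_ne_top
    have hKs : IsSimpleModule Qᵐᵒᵖ (M ⧸ K) := isSimpleModule_iff_isCoatom.mpr hK
    obtain ⟨𝔫, h𝔫, ⟨e⟩⟩ := isSimpleModule_iff_quot_maximal.mp hKs
    obtain ⟨i, ⟨e'⟩⟩ := hiso 𝔫 h𝔫
    refine ⟨i, ?_⟩
    have : Nontrivial (M →ₗ[Qᵐᵒᵖ] (Qᵐᵒᵖ ⧸ 𝔪 i)) := by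
      refine ⟨(e.trans e').toLinearMap ∘ₗ K.mkQ, 0, fun h0 => hK.1 (eq_top_iff.mpr fun x _ => ?_)⟩
      have h1 : (e.trans e') (K.mkQ x) = 0 := LinearMap.congr_fun h0 x
      rw [LinearEquiv.map_eq_zero_iff, Submodule.mkQ_apply, Submodule.Quotient.mk_eq_zero] at h1
      exact h1
    exact Module.finrank_pos
  -- with the ratio `r / n` largest at `j`, a free module of rank `r j` maps onto `M ^ (n j)`, and
  -- at the simple module with index `j` the dimensions of the spaces of maps are equal
  obtain ⟨j, hj0, hj⟩ := exists_ratio_maximal r n hn hr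
  obtain ⟨f, hf⟩ := exists_surjective_pi_of_finrank_le J hJ (Z := M) (r j) (n j) fun 𝔫 h𝔫 => by
    obtain ⟨i, ⟨e⟩⟩ := hiso 𝔫 h𝔫
    rw [finrank_linearMap_end_eq_of_equiv M e, finrank_end_eq_of_equiv e, mul_comm]
    exact hj i
  let P : Submodule k Q := rightModuleAnnihilator k (Qᵐᵒᵖ ⧸ 𝔪 j)
  have hker : ∀ q : Fin (r j) → Qᵐᵒᵖ, f q = 0 → ∀ t, (q t).unop ∈ hopfCore H P := by
    intro q hq t h s
    let _ : SMul H M := ⟨fun h x => ⟨h • (x : Q), hMH h x x.2⟩⟩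
    let _ : Module H M := Function.Injective.module H M.subtype.toAddMonoidHom
      (Submodule.subtype_injective M) fun _ _ => rfl
    refine op_smul_smul_eq_zero_of_map_eq_zero (k := k) (H := H) (X := Fin (n j) → M)
      (Δ := Module.End Qᵐᵒᵖ (Qᵐᵒᵖ ⧸ 𝔪 j)) ?_ f hf ?_ hq h t s
    · intro d C hC a b q x
      funext i
      refine Subtype.ext ?_
      have h1 : C a b • (((x i : Q)) * q.unop) = _ := hC.smul_mul hQ a b _ _
      rw [Finset.sum_apply, AddSubmonoidClass.coe_finsetSum]
      exact h1
    · rw [finrank_linearMap_pi, mul_comm]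
  refine ⟨j, hopfCore H P, isTwoSidedSubspace_hopfCore hQ
    (isTwoSidedSubspace_rightModuleAnnihilator _), isHopfStable_hopfCore P, ?_, hopfCore_le P, ?_⟩
  · by_contra hne
    let L : Ideal Qᵐᵒᵖ :=
      { carrier := {x | x.unop ∈ hopfCore H P ⊔ E}
        add_mem' := fun ha hb => (hopfCore H P ⊔ E).add_mem ha hb
        zero_mem' := (hopfCore H P ⊔ E).zero_mem
        smul_mem' := fun c x hx => by
          obtain ⟨a, ha, b, hb, hab⟩ := Submodule.mem_sup.mp hx
          change x.unop * c.unop ∈ hopfCore H P ⊔ E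
          rw [← hab, add_mul]
          exact add_mem ((le_sup_left : _ ≤ hopfCore H P ⊔ E) ((isTwoSidedSubspace_hopfCore hQ
            (isTwoSidedSubspace_rightModuleAnnihilator _)).mul_mem_right _ ha))
            ((le_sup_right : _ ≤ hopfCore H P ⊔ E) (hE.mul_mem_right _ hb)) }
    have hL : L ≠ ⊤ := fun h => hne (eq_top_iff.mpr fun x _ => by
      have : MulOpposite.op x ∈ L := by rw [h]; trivial
      exact this)
    obtain ⟨𝔫, h𝔫, hL𝔫⟩ := Ideal.exists_le_maximal L hL
    have hann : ∀ X : Submodule k Q, IsTwoSidedSubspace X → X ≤ hopfCore H P ⊔ E →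
        X ≤ rightModuleAnnihilator k (Qᵐᵒᵖ ⧸ 𝔫) := by
      intro X hX hXL x hx s
      obtain ⟨y, rfl⟩ := Submodule.Quotient.mk_surjective 𝔫 s
      rw [← Submodule.Quotient.mk_smul, Submodule.Quotient.mk_eq_zero]
      exact hL𝔫 (hXL (hX.mul_mem_left y.unop hx))
    -- the first coordinate modulo `𝔫` factors through `M ^ (n j)`, which has no maps to `Q ⧸ 𝔫`
    let u : (Fin (r j) → Qᵐᵒᵖ) →ₗ[Qᵐᵒᵖ] (Qᵐᵒᵖ ⧸ 𝔫) := 𝔫.mkQ ∘ₗ LinearMap.proj ⟨0, hj0⟩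
    have hu : LinearMap.ker f ≤ LinearMap.ker u := fun q hq => by
      change 𝔫.mkQ (q ⟨0, hj0⟩) = 0
      rw [Submodule.mkQ_apply, Submodule.Quotient.mk_eq_zero]
      exact hL𝔫 ((le_sup_left : _ ≤ hopfCore H P ⊔ E) (hker q hq _))
    obtain ⟨g, hg⟩ := exists_factor_of_ker_le f hf u hu
    have hg0 : g = 0 := LinearMap.pi_ext' fun i =>
      (hzero 𝔫 (hann E hE le_sup_right) (g ∘ₗ LinearMap.single Qᵐᵒᵖ (fun _ => M) i)).trans
        (LinearMap.zero_comp _).symm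
    have h1 := hg fun _ => 1
    rw [hg0, LinearMap.zero_apply] at h1
    exact h𝔫.ne_top ((Ideal.eq_top_iff_one 𝔫).mpr
      ((Submodule.Quotient.mk_eq_zero 𝔫).mp h1.symm))
  · intro hle
    have h1 := hzero (𝔪 j) hle
    have : Subsingleton (M →ₗ[Qᵐᵒᵖ] (Qᵐᵒᵖ ⧸ 𝔪 j)) := ⟨fun a b => by rw [h1 a, h1 b]⟩
    exact hj0.ne' Module.finrank_zero_of_subsingleton

/-- Every stable ideal is a direct summand, with a stable complement. -/
theorem exists_hopfIdeal_isCompl (J : Ideal Qᵐᵒᵖ) [J.IsTwoSided] [IsSemisimpleRing (Qᵐᵒᵖ ⧸ J)]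
    {N : ℕ} (hJ : J ^ N = ⊥) (hQ : IsHopfModuleAlgebra k H Q) (hsp : IsHopfSemiprime H Q)
    (hnoeth : IsNoetherian Aᵐᵒᵖ A) (hstable : ∀ (h : H), ∀ a ∈ A, h • a ∈ A)
    (hO : IsDenseFilter k H A O) {E : Submodule k Q} (hE : IsTwoSidedSubspace E)
    (hEH : IsHopfStable H E) :
    ∃ X : Submodule k Q, IsTwoSidedSubspace X ∧ IsHopfStable H X ∧ X ⊔ E = ⊤ ∧ X ⊓ E = ⊥ := by
  classical
  obtain ⟨t, 𝔪, h𝔪, hiso⟩ := exists_finite_isMaximal_family J hJ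
  induction hc : (Finset.univ.filter fun i => ¬ E ≤ rightModuleAnnihilator k (Qᵐᵒᵖ ⧸ 𝔪 i)).card
    using Nat.strong_induction_on generalizing E with
  | _ c ih =>
    by_cases hE0 : E = ⊥
    · exact ⟨⊤, ⟨fun _ _ _ => trivial, fun _ _ _ => trivial⟩, fun _ _ _ => trivial, by simp,
        by simp [hE0]⟩
    obtain ⟨j, X₁, h1, h1H, h1E, h1j, hEj⟩ := exists_comaximal_hopfIdeal J hJ hQ hsp hnoeth hstable
      hO 𝔪 h𝔪 hiso hE hEH hE0
    obtain ⟨X₂, h2, h2H, h2E, h2E'⟩ := ih _ (by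
      rw [← hc]
      refine Finset.card_lt_card (Finset.ssubset_iff_of_subset ?_ |>.mpr ⟨j, ?_, ?_⟩)
      · intro i hi
        rw [Finset.mem_filter] at hi ⊢
        exact ⟨hi.1, fun h => hi.2 (inf_le_left.trans h)⟩
      · rw [Finset.mem_filter]
        exact ⟨Finset.mem_univ _, hEj⟩
      · rw [Finset.mem_filter]
        exact fun h => h.2 (inf_le_right.trans h1j)) (hE.inf h1) (hEH.inf h1H) rfl
    refine ⟨X₁ ⊓ X₂, h1.inf h2, h1H.inf h2H, ?_, ?_⟩
    · have hmod : X₁ = (X₁ ⊓ X₂) ⊔ (E ⊓ X₁) := by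
        rw [inf_sup_assoc_of_le X₂ inf_le_right, h2E, inf_top_eq]
      refine eq_top_iff.mpr (h1E.ge.trans (sup_le ?_ le_sup_right))
      conv_lhs => rw [hmod]
      exact sup_le_sup_left inf_le_left _
    · rw [inf_right_comm, inf_comm, inf_comm X₁ E]
      exact h2E'

end Core

/-! ### Least ideals, and right ideals generated by dense subspaces -/

section Least

variable {k Q : Type*} [Field k] [Ring Q] [Algebra k Q]

theorem restrictScalars_pow_le (J : Ideal Q) (n : ℕ) :
    (J.restrictScalars k) ^ n ≤ (J ^ n).restrictScalars k := by
  induction n with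
  | zero =>
    intro x _
    simp [Submodule.pow_zero, Ideal.one_eq_top]
  | succ n ih =>
    rw [pow_succ]
    refine Submodule.mul_le.mpr fun x hx y hy => ?_
    rw [Submodule.restrictScalars_mem, Submodule.pow_succ]
    exact Submodule.mul_mem_mul (ih hx) hy

/-- In a ring that is semisimple modulo a nilpotent ideal `J`, a family of two-sided ideals closed
under intersections and products has a least member: if the image of `X` modulo `J` is minimal then
a power of `X` lies in all members. -/
theorem exists_least_of_inf_mul_closed (J : Ideal Q) [J.IsTwoSided] [IsSemisimpleRing (Q ⧸ J)]
    {N : ℕ} (hJ : J ^ N = ⊥) (F : Set (Submodule k Q)) (hne : F.Nonempty)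
    (hF : ∀ X ∈ F, IsTwoSidedSubspace X) (hinf : ∀ X ∈ F, ∀ Y ∈ F, X ⊓ Y ∈ F)
    (hmul : ∀ X ∈ F, ∀ Y ∈ F, X * Y ∈ F) : ∃ D ∈ F, ∀ Y ∈ F, D ≤ Y := by
  let toIdeal : F → Ideal Q := fun X =>
    { carrier := (X : Submodule k Q)
      add_mem' := (X : Submodule k Q).add_mem
      zero_mem' := (X : Submodule k Q).zero_mem
      smul_mem' := fun q _ hx => (hF X X.2).mul_mem_left q hx }
  obtain ⟨_, ⟨X, rfl⟩, hX⟩ := (wellFounded_lt (α := Submodule Q (Q ⧸ J))).has_min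
    (Set.range fun X : F => Submodule.map J.mkQ (toIdeal X)) ⟨_, ⟨⟨_, hne.choose_spec⟩, rfl⟩⟩
  have hJX : ∀ Y ∈ F, (X : Submodule k Q) ≤ Y ⊔ J.restrictScalars k := by
    intro Y hY x hx
    have h1 : Submodule.map J.mkQ (toIdeal ⟨X ⊓ Y, hinf X X.2 Y hY⟩) =
        Submodule.map J.mkQ (toIdeal X) := by
      by_contra hne
      refine hX _ ⟨_, rfl⟩ (lt_of_le_of_ne (Submodule.map_mono fun x hx => ?_) hne)
      exact hx.1
    have h2 : J.mkQ x ∈ Submodule.map J.mkQ (toIdeal X) := ⟨x, hx, rfl⟩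
    rw [← h1] at h2
    obtain ⟨y, hy, hxy⟩ := h2
    rw [Submodule.mkQ_apply, Submodule.mkQ_apply, eq_comm, Submodule.Quotient.eq] at hxy
    exact Submodule.mem_sup.mpr ⟨y, hy.2, x - y, hxy, by simp⟩
  have hpow : ∀ Y ∈ F, ∀ n : ℕ,
      (X : Submodule k Q) ^ (n + 1) ≤ Y ⊔ (J.restrictScalars k) ^ (n + 1) := by
    intro Y hY n
    have hY' := hF Y hY
    induction n with
    | zero => simpa using hJX Y hY
    | succ n ih =>
      rw [pow_succ]
      refine Submodule.mul_le.mpr fun x hx z hz => ?_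
      obtain ⟨y₁, hy₁, j₁, hj₁, rfl⟩ := Submodule.mem_sup.mp (ih hx)
      obtain ⟨y₂, hy₂, j₂, hj₂, rfl⟩ := Submodule.mem_sup.mp (hJX Y hY hz)
      rw [add_mul, mul_add j₁, ← add_assoc]
      refine add_mem (add_mem ?_ ?_) ?_
      · exact (le_sup_left : Y ≤ Y ⊔ _) (hY'.mul_mem_right _ hy₁)
      · exact (le_sup_left : Y ≤ Y ⊔ _) (hY'.mul_mem_left _ hy₂)
      · rw [pow_succ (J.restrictScalars k)]
        exact (le_sup_right : _ ≤ Y ⊔ _) (Submodule.mul_mem_mul hj₁ hj₂)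
  have hXpow : ∀ n : ℕ, (X : Submodule k Q) ^ (n + 1) ∈ F := fun n => by
    induction n with
    | zero => simp [X.2]
    | succ n ih => rw [pow_succ]; exact hmul _ ih _ X.2
  refine ⟨_, hXpow N, fun Y hY => (hpow Y hY N).trans (sup_le le_rfl ?_)⟩
  refine (restrictScalars_pow_le J (N + 1)).trans fun x hx => ?_
  rw [Submodule.restrictScalars_mem, Submodule.pow_succ, hJ, Submodule.bot_mul] at hx
  rw [(Submodule.mem_bot Q).mp hx]
  exact Y.zero_mem

end Least

section RightSpan

variable {k H Q : Type*} [Field k] [Ring H] [HopfAlgebra k H] [Ring Q] [Algebra k Q]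
  [Module H Q] [IsScalarTower k H Q] {A : Subalgebra k Q} {O : Set (Submodule k Q)}

theorem IsDenseFilter.top_mem (hO : IsDenseFilter k H A O) : ⊤ ∈ O :=
  hO.mono hO.toSubmodule_mem le_top

theorem IsDenseFilter.iInf_mem (hO : IsDenseFilter k H A O) {ι : Type*} [Finite ι]
    {V : ι → Submodule k Q} (hV : ∀ i, V i ∈ O) : ⨅ i, V i ∈ O := by
  have := Fintype.ofFinite ι
  rw [← Finset.inf_univ_eq_iInf]
  exact Finset.inf_induction hO.top_mem (fun _ ha _ hb => hO.inf_mem ha hb) fun i _ => hV i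

theorem IsTwoSidedSubspace.mul {X Y : Submodule k Q} (hX : IsTwoSidedSubspace X)
    (hY : IsTwoSidedSubspace Y) : IsTwoSidedSubspace (X * Y) := by
  refine ⟨fun q x hx => ?_, fun q x hx => ?_⟩
  · induction hx using Submodule.mul_induction_on' with
    | mem_mul_mem a ha b hb =>
      rw [← mul_assoc]; exact Submodule.mul_mem_mul (hX.mul_mem_left q ha) hb
    | add a _ b _ ha hb => rw [mul_add]; exact add_mem ha hb
  · induction hx using Submodule.mul_induction_on' with
    | mem_mul_mem a ha b hb =>
      rw [mul_assoc]; exact Submodule.mul_mem_mul ha (hY.mul_mem_right q hb)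
    | add a _ b _ ha hb => rw [add_mul]; exact add_mem ha hb

/-- The elements of `Q` sent to `P` by all `S(C_ij)`. -/
def antipodeComap {d : ℕ} (C : Fin d → Fin d → H) (P : Submodule k Q) : Submodule k Q :=
  ⨅ p : Fin d × Fin d, P.comap (DistribSMul.toLinearMap k Q (HopfAlgebra.antipode k (C p.1 p.2)))

theorem mem_antipodeComap {d : ℕ} {C : Fin d → Fin d → H} {P : Submodule k Q} {q : Q} :
    q ∈ antipodeComap C P ↔ ∀ i j, HopfAlgebra.antipode k (C i j) • q ∈ P := by
  simp [antipodeComap, Submodule.mem_iInf]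

theorem isTwoSidedSubspace_antipodeComap (hQ : IsHopfModuleAlgebra k H Q) {d : ℕ}
    {C : Fin d → Fin d → H} (hC : IsMultiplicativeMatrix k C) {P : Submodule k Q}
    (hP : IsTwoSidedSubspace P) : IsTwoSidedSubspace (antipodeComap C P) := by
  refine ⟨fun q x hx => ?_, fun q x hx => ?_⟩
  all_goals
    rw [mem_antipodeComap] at hx ⊢
    intro i j
    rw [hC.antipode_smul_mul hQ]
  · exact Submodule.sum_mem _ fun l _ => hP.mul_mem_left _ (hx _ _)
  · exact Submodule.sum_mem _ fun l _ => hP.mul_mem_right _ (hx _ _)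

theorem antipode_smul_mem_of_le_antipodeComap {D P : Submodule k Q}
    (h : ∀ (d : ℕ) (C : Fin d → Fin d → H), IsMultiplicativeMatrix k C → D ≤ antipodeComap C P)
    (g : H) {x : Q} (hx : x ∈ D) : HopfAlgebra.antipode k g • x ∈ P :=
  mem_of_forall_isMultiplicativeMatrix
    (P.comap (hopfOrbitMap k H x ∘ₗ HopfAlgebra.antipode k (A := H)))
    (fun d C hC i j => mem_antipodeComap.mp (h d C hC hx) i j) g

/-- A two-sided ideal of `Q` containing a member of the Gabriel topology is the whole of `Q`. -/
theorem eq_top_of_isTwoSidedSubspace (J : Ideal Q) [J.IsTwoSided] [IsSemisimpleRing (Q ⧸ J)]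
    {N : ℕ} (hJ : J ^ N = ⊥) (hQ : IsHopfModuleAlgebra k H Q) (hsp : IsHopfSemiprime H Q)
    (hnoeth : IsNoetherian Aᵐᵒᵖ A) (hstable : ∀ (h : H), ∀ a ∈ A, h • a ∈ A)
    (hfinite : ∀ a ∈ A, FiniteDimensional k (LinearMap.range (hopfOrbitMap k H a)))
    (hO : IsDenseFilter k H A O) {P : Submodule k Q} (hP : IsTwoSidedSubspace P) (hPO : P ∈ O) :
    P = ⊤ := by
  obtain ⟨J', _, _, hJ'⟩ := exists_opposite_ideal J hJ
  obtain ⟨D, ⟨hD, hDO⟩, hDmin⟩ := exists_least_of_inf_mul_closed J hJ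
    {X : Submodule k Q | IsTwoSidedSubspace X ∧ X ∈ O} ⟨P, hP, hPO⟩ (fun X hX => hX.1)
    (fun X hX Y hY => ⟨hX.1.inf hY.1, hO.inf_mem hX.2 hY.2⟩)
    (fun X hX Y hY => ⟨hX.1.mul hY.1, hO.mul_mem hX.2 hY.2⟩)
  have hDS : ∀ h : H, ∀ x ∈ D, HopfAlgebra.antipode k h • x ∈ D := fun h x hx =>
    antipode_smul_mem_of_le_antipodeComap (fun d C hC => hDmin _
      ⟨isTwoSidedSubspace_antipodeComap hQ hC hD,
        hO.iInf_mem fun p => hO.comap_antipode_mem hDO _⟩) h hx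
  have hDA : IsHopfStable H (D ⊓ Subalgebra.toSubmodule A) := fun h x hx =>
    smul_mem_of_antipode_smul_mem (D ⊓ Subalgebra.toSubmodule A) (fun a ha => hfinite a ha.2)
      (fun g y hy => ⟨hDS g y hy.1, hstable _ y hy.2⟩) h hx
  have hEO : hopfCore H D ∈ O :=
    hO.mono (hO.inf_mem hDO hO.toSubmodule_mem) (le_hopfCore hDA inf_le_left)
  have hE := isTwoSidedSubspace_hopfCore hQ hD (H := H)
  obtain ⟨X, hX, -, hXE, hXE'⟩ := exists_hopfIdeal_isCompl J' hJ' hQ hsp hnoeth hstable hO hE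
    (isHopfStable_hopfCore D)
  have hX0 : X = ⊥ := eq_bot_iff.mpr fun x hx =>
    hO.eq_zero_of_mul_eq_zero hEO x fun w hw => by
      have : x * w ∈ X ⊓ hopfCore H D := ⟨hX.mul_mem_right w hx, hE.mul_mem_left x hw⟩
      rwa [hXE', Submodule.mem_bot] at this
  rw [hX0, bot_sup_eq] at hXE
  exact eq_top_iff.mpr (hXE.ge.trans ((hopfCore_le D).trans (hDmin P ⟨hP, hPO⟩)))

theorem module_finite_op_self : Module.Finite Qᵐᵒᵖ Q :=
  ⟨⟨{1}, eq_top_iff.mpr fun x _ => by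
    simpa using Submodule.mem_span_singleton.mpr ⟨MulOpposite.op x, by simp⟩⟩⟩

/-- A subspace containing a member of the Gabriel topology generates `Q` as a right ideal. -/
theorem span_op_eq_top (J : Ideal Q) [J.IsTwoSided] [IsSemisimpleRing (Q ⧸ J)]
    {N : ℕ} (hJ : J ^ N = ⊥) (hQ : IsHopfModuleAlgebra k H Q) (hsp : IsHopfSemiprime H Q)
    (hnoeth : IsNoetherian Aᵐᵒᵖ A) (hstable : ∀ (h : H), ∀ a ∈ A, h • a ∈ A)
    (hfinite : ∀ a ∈ A, FiniteDimensional k (LinearMap.range (hopfOrbitMap k H a)))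
    (hO : IsDenseFilter k H A O) {W : Submodule k Q} (hW : W ∈ O) :
    Submodule.span Qᵐᵒᵖ (W : Set Q) = ⊤ := by
  classical
  obtain ⟨J', _, _, hJ'⟩ := exists_opposite_ideal J hJ
  have := module_finite_op_self (Q := Q)
  refine (eq_top_or_exists_le_coatom _).resolve_right ?_
  rintro ⟨m, hm, hWm⟩
  have hS : IsSimpleModule Qᵐᵒᵖ (Q ⧸ m) := isSimpleModule_iff_isCoatom.mpr hm
  have hfin := module_finite_end_of_isSimpleModule J' hJ' (Q ⧸ m)
  obtain ⟨n, s, hs⟩ := Module.Finite.exists_fin (R := Module.End Qᵐᵒᵖ (Q ⧸ m)) (M := Q ⧸ m)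
  choose r hr using fun i => m.mkQ_surjective (s i)
  let V : Fin n → Submodule k Q := fun i =>
    (m.restrictScalars k).comap (LinearMap.mulLeft k (r i))
  have hV : ⨅ i, V i ∈ O := hO.iInf_mem fun i => hO.comap_mulLeft_mem
    (hO.mono hW (Submodule.subset_span.trans hWm : (W : Set Q) ⊆ m)) _
  have hP : rightModuleAnnihilator k (Q := Q) (Q ⧸ m) = ⊤ := by
    refine eq_top_of_isTwoSidedSubspace J hJ hQ hsp hnoeth hstable hfinite hO
      (isTwoSidedSubspace_rightModuleAnnihilator _) (hO.mono hV fun q hq x => ?_)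
    have hx : x ∈ Submodule.span (Module.End Qᵐᵒᵖ (Q ⧸ m)) (Set.range s) := by
      rw [hs]; trivial
    induction hx using Submodule.span_induction with
    | mem x hx =>
      obtain ⟨i, rfl⟩ := hx
      rw [← hr i, ← map_smul, Submodule.mkQ_apply, Submodule.Quotient.mk_eq_zero]
      exact (Submodule.mem_iInf _).mp hq i
    | zero => rw [smul_zero]
    | add x y _ _ hx hy => rw [smul_add, hx, hy, add_zero]
    | smul c x _ hx => rw [smul_comm, hx, smul_zero]
  refine hm.1 (eq_top_iff.mpr fun x _ => ?_)
  have h1 : (1 : Q) ∈ rightModuleAnnihilator k (Q := Q) (Q ⧸ m) := by rw [hP]; trivial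
  have h2 := h1 (m.mkQ x)
  rwa [MulOpposite.op_one, one_smul, Submodule.mkQ_apply, Submodule.Quotient.mk_eq_zero] at h2

end RightSpan

/-! ### Left ideals generated by dense subspaces -/

section LeftSpan

variable {k H Q : Type*} [Field k] [Ring H] [HopfAlgebra k H] [Ring Q] [Module H Q]

variable (k) in
/-- The action of `Q` on `S ^ d` twisted by the matrix `S(C)`:
`(a z)_i = ∑ (S(C_ji) a) z_j`. -/
def antipodeTwist {d : ℕ} (C : Fin d → Fin d → H) (S : Type*) [AddCommGroup S]
    [Module Q S] : Q →+ (Fin d → S) →+ (Fin d → S) where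
  toFun a :=
    { toFun := fun z i => ∑ j, (HopfAlgebra.antipode k (C j i) • a) • z j
      map_zero' := by funext i; simp
      map_add' := fun z w => by funext i; simp [Finset.sum_add_distrib] }
  map_zero' := by
    refine AddMonoidHom.ext fun z => funext fun i => ?_
    simp
  map_add' a b := by
    refine AddMonoidHom.ext fun z => funext fun i => ?_
    simp [Finset.sum_add_distrib, add_smul]

theorem antipodeTwist_apply {d : ℕ} (C : Fin d → Fin d → H) (S : Type*) [AddCommGroup S]
    [Module Q S] (a : Q) (z : Fin d → S) (i : Fin d) :
    antipodeTwist k C S a z i = ∑ j, (HopfAlgebra.antipode k (C j i) • a) • z j :=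
  rfl

variable [Algebra k Q] [IsScalarTower k H Q]

theorem antipodeTwist_mul (hQ : IsHopfModuleAlgebra k H Q) {d : ℕ} {C : Fin d → Fin d → H}
    (hC : IsMultiplicativeMatrix k C) (S : Type*) [AddCommGroup S] [Module Q S] (a b : Q)
    (z : Fin d → S) :
    antipodeTwist k C S (a * b) z = antipodeTwist k C S a (antipodeTwist k C S b z) := by
  funext i
  simp only [antipodeTwist_apply, hC.antipode_smul_mul hQ, Finset.sum_smul, Finset.smul_sum,
    mul_smul]
  rw [Finset.sum_comm]

/-- If `Q ^ n → (Q ⧸ Q W) ^ m` is onto and the subspace `U` of `S` has, relative to `S`, the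
dimension that this map suggests, then the elements of the kernel have coordinates which `S(C)`
moves into the annihilator of `S`, as soon as `S(C_ij) W` kills `U`. -/
theorem antipode_smul_smul_eq_zero_of_map_eq_zero (hQ : IsHopfModuleAlgebra k H Q) {d : ℕ}
    {C : Fin d → Fin d → H} (hC : IsMultiplicativeMatrix k C) {S Δ : Type*} [AddCommGroup S]
    [Module Q S] [DivisionRing Δ] [Module Δ S] [SMulCommClass Q Δ S] [Module.Finite Δ S]
    (U : Submodule Δ S) {W : Set Q}
    (hU : ∀ i j, ∀ w ∈ W, ∀ s ∈ U, (HopfAlgebra.antipode k (C i j) • w) • s = 0) {n m : ℕ}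
    (f : (Fin n → Q) →ₗ[Q] (Fin m → Q ⧸ Ideal.span W)) (hf : Function.Surjective f)
    (hdim : m * Module.finrank Δ U = n * Module.finrank Δ S) {x : Fin n → Q} (hx : f x = 0)
    (t : Fin n) (i j : Fin d) (s : S) : (HopfAlgebra.antipode k (C i j) • x t) • s = 0 := by
  choose y hy using fun t p => Submodule.Quotient.mk_surjective (Ideal.span W)
    (f (Pi.single t 1) p)
  have hfy : ∀ x p, f x p = Submodule.Quotient.mk (∑ t, x t * y t p) := fun x p => by
    have h1 : x = ∑ t, x t • (Pi.single t 1 : Fin n → Q) := by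
      funext t
      simp [Finset.sum_apply, Pi.single_apply]
    conv_lhs => rw [h1]
    rw [map_sum, Finset.sum_apply, ← Submodule.mkQ_apply, map_sum]
    refine Finset.sum_congr rfl fun t _ => ?_
    rw [map_smul, Pi.smul_apply, ← hy, Submodule.mkQ_apply, ← smul_eq_mul,
      Submodule.Quotient.mk_smul]
  have hkill : ∀ a ∈ Ideal.span W, ∀ z : Fin d → U,
      antipodeTwist k C S a (fun i => (z i : S)) = 0 := by
    intro a ha z
    induction ha using Submodule.span_induction with
    | mem a ha =>
      funext i
      rw [antipodeTwist_apply]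
      exact Finset.sum_eq_zero fun j _ => hU j i a ha _ (z j).2
    | zero => simp
    | add a b _ _ h₁ h₂ => rw [map_add, AddMonoidHom.add_apply, h₁, h₂, add_zero]
    | smul c a _ h₁ => rw [smul_eq_mul, antipodeTwist_mul hQ hC, h₁, map_zero]
  -- the twisted evaluation at the images of the basis vectors under `f`
  let Ξ : (Fin m → Fin d → U) →ₗ[Δ] (Fin n → Fin d → S) :=
    { toFun := fun z t => ∑ p, antipodeTwist k C S (y t p) fun i => (z p i : S)
      map_add' := fun z w => by
        funext t i
        simp [antipodeTwist_apply, Finset.sum_add_distrib]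
      map_smul' := fun c z => by
        funext t i
        simp only [antipodeTwist_apply, Finset.sum_apply, Pi.smul_apply, Submodule.coe_smul,
          Finset.smul_sum, RingHom.id_apply]
        exact Finset.sum_congr rfl fun _ _ => Finset.sum_congr rfl fun _ _ => smul_comm _ _ _ }
  have hΞ : ∀ (x : Fin n → Q) z, ∑ t, antipodeTwist k C S (x t) (Ξ z t) =
      ∑ p, antipodeTwist k C S (∑ t, x t * y t p) fun i => (z p i : S) := by
    intro x z
    simp only [Ξ, LinearMap.coe_mk, AddHom.coe_mk, map_sum, AddMonoidHom.finsetSum_apply,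
      antipodeTwist_mul hQ hC]
    rw [Finset.sum_comm]
  have hinj : Function.Injective Ξ := by
    rw [injective_iff_map_eq_zero]
    intro z hz
    have h0 : ∀ p (a : Q), antipodeTwist k C S a (fun i => (z p i : S)) = 0 := by
      intro p a
      obtain ⟨x, hx⟩ := hf (Pi.single p (Submodule.Quotient.mk a))
      have h1 := hΞ x z
      rw [hz] at h1
      simp only [Pi.zero_apply, map_zero, Finset.sum_const_zero] at h1
      rw [Finset.sum_eq_single p] at h1
      · have h2 : a - ∑ t, x t * y t p ∈ Ideal.span W := by
          rw [← Submodule.Quotient.eq, ← hfy, hx, Pi.single_eq_same]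
        have h3 := hkill _ h2 (z p)
        rw [map_sub, AddMonoidHom.sub_apply, ← h1, sub_zero] at h3
        exact h3
      · intro p' _ hp'
        refine hkill _ ?_ _
        rw [← Submodule.Quotient.mk_eq_zero, ← hfy, hx, Pi.single_eq_of_ne hp']
      · simp
    funext p q
    refine Subtype.ext ?_
    have h1 : ∑ i, antipodeTwist k C S (C i q • (1 : Q)) (fun j => (z p j : S)) i = 0 :=
      Finset.sum_eq_zero fun i _ => by rw [h0]; rfl
    simp only [antipodeTwist_apply] at h1
    rw [Finset.sum_comm] at h1
    simp only [← Finset.sum_smul, hC.sum_antipode_smul] at h1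
    simpa [ite_smul] using h1
  have hrank : Module.finrank Δ (Fin m → Fin d → U) = Module.finrank Δ (Fin n → Fin d → S) := by
    simp only [Module.finrank_pi_fintype, Finset.sum_const, Finset.card_univ, Fintype.card_fin,
      smul_eq_mul]
    rw [mul_left_comm, hdim, mul_left_comm]
  obtain ⟨z, hz⟩ := (LinearMap.injective_iff_surjective_of_finrank_eq_finrank hrank).mp hinj
    (Pi.single t (Pi.single i s))
  have h1 := hΞ x z
  have h2 : ∑ p, antipodeTwist k C S (∑ t, x t * y t p) (fun i => (z p i : S)) = 0 :=
    Finset.sum_eq_zero fun p _ => hkill _ (by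
      rw [← Submodule.Quotient.mk_eq_zero, ← hfy, hx]; rfl) _
  rw [h2, hz, Finset.sum_eq_single t (fun t' _ ht' => by rw [Pi.single_eq_of_ne ht', map_zero])
    (by simp)] at h1
  have h3 := congrFun h1 j
  rw [Pi.single_eq_same, antipodeTwist_apply, Finset.sum_eq_single i
    (fun l _ hl => by rw [Pi.single_eq_of_ne hl, smul_zero]) (by simp)] at h3
  simpa using h3

variable {A : Subalgebra k Q} {O : Set (Submodule k Q)}

/-- The elements of a left `Q`-module killed by `W`. -/
def moduleRightAnnihilator (Δ : Type*) (S : Type*) [Ring Δ] [AddCommGroup S] [Module Q S]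
    [Module Δ S] [SMulCommClass Q Δ S] (W : Submodule k Q) : Submodule Δ S where
  carrier := {s | ∀ w ∈ W, w • s = 0}
  add_mem' ha hb w hw := by rw [smul_add, ha w hw, hb w hw, add_zero]
  zero_mem' w _ := smul_zero w
  smul_mem' c s hs w hw := by rw [smul_comm, hs w hw, smul_zero]

theorem moduleRightAnnihilator_anti (Δ : Type*) (S : Type*) [Ring Δ] [AddCommGroup S]
    [Module Q S] [Module Δ S] [SMulCommClass Q Δ S] {V W : Submodule k Q} (h : V ≤ W) :
    moduleRightAnnihilator Δ S W ≤ moduleRightAnnihilator Δ S V :=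
  fun _ hs w hw => hs w (h hw)

/-- Maps `Q ⧸ Q W → S` are determined by the image of `1`, which is killed by `W`. -/
theorem finrank_quotient_linearMap_le (Δ : Type*) (S : Type*) [DivisionRing Δ] [AddCommGroup S]
    [Module Q S] [Module Δ S] [SMulCommClass Q Δ S] [Module.Finite Δ S] (W : Submodule k Q) :
    Module.finrank Δ ((Q ⧸ Ideal.span (W : Set Q)) →ₗ[Q] S) ≤
      Module.finrank Δ (moduleRightAnnihilator Δ S W) := by
  let e : ((Q ⧸ Ideal.span (W : Set Q)) →ₗ[Q] S) →ₗ[Δ] moduleRightAnnihilator Δ S W :=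
    { toFun := fun φ => ⟨φ (Submodule.Quotient.mk 1), fun w hw => by
        rw [← map_smul, ← Submodule.Quotient.mk_smul, smul_eq_mul, mul_one,
          (Submodule.Quotient.mk_eq_zero _).mpr (Ideal.subset_span hw), map_zero]⟩
      map_add' := fun _ _ => rfl
      map_smul' := fun _ _ => rfl }
  refine LinearMap.finrank_le_finrank_of_injective (f := e) fun φ ψ h => LinearMap.ext fun x => ?_
  obtain ⟨q, rfl⟩ := Submodule.Quotient.mk_surjective _ x
  have h1 : φ (Submodule.Quotient.mk 1) = ψ (Submodule.Quotient.mk 1) := congrArg Subtype.val h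
  have h2 : (Submodule.Quotient.mk q : Q ⧸ Ideal.span (W : Set Q)) =
      q • Submodule.Quotient.mk 1 := by
    rw [← Submodule.Quotient.mk_smul, smul_eq_mul, mul_one]
  rw [h2, map_smul, map_smul, h1]

end LeftSpan

/-! ### Ideals invariant under the antipode, and simple left modules -/

section LeftSpanTop

variable {k H Q : Type*} [Field k] [Ring H] [HopfAlgebra k H] [Ring Q] [Algebra k Q]
  [Module H Q] [IsScalarTower k H Q]

variable (k) in
/-- The annihilator in `Q` of a left `Q`-module. -/
def leftModuleAnnihilator (S : Type*) [AddCommGroup S] [Module Q S] [Module k S]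
    [IsScalarTower k Q S] : Submodule k Q where
  carrier := {q | ∀ s : S, q • s = 0}
  add_mem' ha hb s := by rw [add_smul, ha s, hb s, add_zero]
  zero_mem' s := zero_smul Q s
  smul_mem' c q hq s := by rw [smul_assoc, hq s, smul_zero]

theorem isTwoSidedSubspace_leftModuleAnnihilator (S : Type*) [AddCommGroup S] [Module Q S]
    [Module k S] [IsScalarTower k Q S] :
    IsTwoSidedSubspace (leftModuleAnnihilator k (Q := Q) S) :=
  ⟨fun q x hx s => by rw [mul_smul, hx, smul_zero], fun q x hx s => by rw [mul_smul, hx]⟩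

/-- The largest subspace of `P` stable under the image of the antipode. -/
def antipodeCore (H : Type*) [Ring H] [HopfAlgebra k H] [Module H Q] [IsScalarTower k H Q]
    (P : Submodule k Q) : Submodule k Q :=
  ⨅ h : H, P.comap (DistribSMul.toLinearMap k Q (HopfAlgebra.antipode k h))

theorem mem_antipodeCore {P : Submodule k Q} {q : Q} :
    q ∈ antipodeCore H P ↔ ∀ h : H, HopfAlgebra.antipode k h • q ∈ P := by
  simp [antipodeCore, Submodule.mem_iInf]

theorem mem_antipodeCore_iff_mem_antipodeComap {P : Submodule k Q} {q : Q} :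
    q ∈ antipodeCore H P ↔ ∀ (d : ℕ) (C : Fin d → Fin d → H), IsMultiplicativeMatrix k C →
      q ∈ antipodeComap C P :=
  mem_antipodeCore.trans ⟨fun h _ _ _ => mem_antipodeComap.mpr fun _ _ => h _, fun h g =>
    mem_of_forall_isMultiplicativeMatrix
      (P.comap (hopfOrbitMap k H q ∘ₗ HopfAlgebra.antipode k (A := H)))
      (fun d C hC i j => mem_antipodeComap.mp (h d C hC) i j) g⟩

theorem antipodeCore_le (P : Submodule k Q) : antipodeCore H P ≤ P := fun q hq => by
  simpa using mem_antipodeCore.mp hq 1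

theorem antipode_smul_mem_antipodeCore {P : Submodule k Q} (g : H) {q : Q}
    (hq : q ∈ antipodeCore H P) : HopfAlgebra.antipode k g • q ∈ antipodeCore H P :=
  mem_antipodeCore.mpr fun h => by
    rw [smul_smul, ← HopfAlgebra.antipode_mul_antidistrib]
    exact mem_antipodeCore.mp hq _

theorem isTwoSidedSubspace_antipodeCore (hQ : IsHopfModuleAlgebra k H Q) {P : Submodule k Q}
    (hP : IsTwoSidedSubspace P) : IsTwoSidedSubspace (antipodeCore H P) := by
  refine ⟨fun q x hx => ?_, fun q x hx => ?_⟩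
  all_goals
    rw [mem_antipodeCore_iff_mem_antipodeComap] at hx ⊢
    intro d C hC
  · exact (isTwoSidedSubspace_antipodeComap hQ hC hP).mul_mem_left q (hx d C hC)
  · exact (isTwoSidedSubspace_antipodeComap hQ hC hP).mul_mem_right q (hx d C hC)

variable {A : Subalgebra k Q} {O : Set (Submodule k Q)}

/-- An ideal `P` equals `Q` if, for each multiplicative matrix `C`, the ideal of elements sent to
`P` by `S(C)` has zero right annihilator. -/
theorem eq_top_of_antipodeComap (J : Ideal Q) [J.IsTwoSided] [IsSemisimpleRing (Q ⧸ J)]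
    {N : ℕ} (hJ : J ^ N = ⊥) (hQ : IsHopfModuleAlgebra k H Q) (hsp : IsHopfSemiprime H Q)
    (hnoeth : IsNoetherian Aᵐᵒᵖ A) (hstable : ∀ (h : H), ∀ a ∈ A, h • a ∈ A)
    (hfinite : ∀ a ∈ A, FiniteDimensional k (LinearMap.range (hopfOrbitMap k H a)))
    (hO : IsDenseFilter k H A O) {P : Submodule k Q} (hP : IsTwoSidedSubspace P)
    (hPC : ∀ (d : ℕ) (C : Fin d → Fin d → H), IsMultiplicativeMatrix k C →
      ∀ v : Q, (∀ x ∈ antipodeComap C P, x * v = 0) → v = 0) : P = ⊤ := by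
  obtain ⟨J', _, _, hJ'⟩ := exists_opposite_ideal J hJ
  have hmul : ∀ X Y : Submodule k Q, (∀ v : Q, (∀ x ∈ X, x * v = 0) → v = 0) →
      (∀ v : Q, (∀ x ∈ Y, x * v = 0) → v = 0) → ∀ v : Q, (∀ x ∈ X * Y, x * v = 0) → v = 0 :=
    fun X Y hX hY v hv => hY v fun y hy => hX _ fun x hx => by
      rw [← mul_assoc]
      exact hv _ (Submodule.mul_mem_mul hx hy)
  obtain ⟨D, ⟨-, hD⟩, hDmin⟩ := exists_least_of_inf_mul_closed J hJ
    {X : Submodule k Q | IsTwoSidedSubspace X ∧ ∀ v : Q, (∀ x ∈ X, x * v = 0) → v = 0}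
    ⟨⊤, ⟨fun _ _ _ => trivial, fun _ _ _ => trivial⟩, fun v hv => by simpa using hv 1 trivial⟩
    (fun X hX => hX.1)
    (fun X hX Y hY => ⟨hX.1.inf hY.1, fun v hv => hmul X Y hX.2 hY.2 v fun x hx => hv x
      ((Submodule.mul_le (P := X ⊓ Y)).mpr (fun a ha b hb =>
        ⟨hX.1.mul_mem_right b ha, hY.1.mul_mem_left a hb⟩) hx)⟩)
    (fun X hX Y hY => ⟨hX.1.mul hY.1, hmul X Y hX.2 hY.2⟩)
  have hDS : D ≤ antipodeCore H P := fun x hx =>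
    mem_antipodeCore_iff_mem_antipodeComap.mpr fun d C hC =>
      hDmin _ ⟨isTwoSidedSubspace_antipodeComap hQ hC hP, hPC d C hC⟩ hx
  have hS := isTwoSidedSubspace_antipodeCore hQ hP (H := H)
  have hSA : IsHopfStable H (antipodeCore H P ⊓ Subalgebra.toSubmodule A) := fun h x hx =>
    smul_mem_of_antipode_smul_mem (antipodeCore H P ⊓ Subalgebra.toSubmodule A)
      (fun a ha => hfinite a ha.2)
      (fun g y hy => ⟨antipode_smul_mem_antipodeCore g hy.1, hstable _ y hy.2⟩) h hx
  set E := hopfCore H (antipodeCore H P) with hEdef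
  have hE : IsTwoSidedSubspace E := isTwoSidedSubspace_hopfCore hQ hS
  -- the ideal `antipodeCore H P` is generated by its intersection with `A`
  have hSE : antipodeCore H P ≤ E := by
    intro q hq
    have htop := span_op_eq_top J hJ hQ hsp hnoeth hstable hfinite hO
      (hO.inf_mem hO.toSubmodule_mem (hO.comap_mulLeft_mem hO.toSubmodule_mem q))
    have hmem : ∀ x ∈ Submodule.span Qᵐᵒᵖ ((Subalgebra.toSubmodule A ⊓
        (Subalgebra.toSubmodule A).comap (LinearMap.mulLeft k q) : Submodule k Q) : Set Q),
        q * x ∈ E := by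
      intro x hx
      induction hx using Submodule.span_induction with
      | mem x hx => exact le_hopfCore hSA inf_le_left ⟨hS.mul_mem_right x hq, hx.2⟩
      | zero => rw [mul_zero]; exact E.zero_mem
      | add x y _ _ hx hy => rw [mul_add]; exact E.add_mem hx hy
      | smul c x _ hx =>
        rw [mul_smul_comm]
        exact hE.mul_mem_right c.unop hx
    have := hmem 1 (by rw [htop]; trivial)
    rwa [mul_one] at this
  obtain ⟨X, hX, -, hXE, hXE'⟩ := exists_hopfIdeal_isCompl J' hJ' hQ hsp hnoeth hstable hO hE
    (isHopfStable_hopfCore _)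
  have hX0 : X = ⊥ := eq_bot_iff.mpr fun x hx => hD x fun w hw => by
    have : w * x ∈ X ⊓ E := ⟨hX.mul_mem_left w hx, hE.mul_mem_right x (hSE (hDS hw))⟩
    rwa [hXE', Submodule.mem_bot] at this
  rw [hX0, bot_sup_eq] at hXE
  exact eq_top_iff.mpr (hXE.ge.trans ((hopfCore_le _).trans (antipodeCore_le P)))

theorem exists_maximal_finrank (hO : O.Nonempty) (f : Submodule k Q → ℕ) (b : ℕ)
    (hf : ∀ W, f W ≤ b) : ∃ V ∈ O, ∀ W ∈ O, f W ≤ f V := by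
  obtain ⟨V, hV, hmax⟩ := Set.Finite.exists_maximalFor' f O
    ((Set.finite_Iic b).subset (by rintro _ ⟨W, -, rfl⟩; exact hf W)) hO
  exact ⟨V, hV, fun W hW => (le_total (f W) (f V)).elim id (hmax hW)⟩

/-- A subspace containing a member of the Gabriel topology generates `Q` as a left ideal. -/
theorem ideal_span_eq_top (J : Ideal Q) [J.IsTwoSided] [IsSemisimpleRing (Q ⧸ J)]
    {N : ℕ} (hJ : J ^ N = ⊥) (hQ : IsHopfModuleAlgebra k H Q) (hsp : IsHopfSemiprime H Q)
    (hnoeth : IsNoetherian Aᵐᵒᵖ A) (hstable : ∀ (h : H), ∀ a ∈ A, h • a ∈ A)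
    (hfinite : ∀ a ∈ A, FiniteDimensional k (LinearMap.range (hopfOrbitMap k H a)))
    (hO : IsDenseFilter k H A O) {W : Submodule k Q} (hW : W ∈ O) :
    Ideal.span (W : Set Q) = ⊤ := by
  classical
  obtain ⟨t, 𝔪, h𝔪, hiso⟩ := exists_finite_isMaximal_family J hJ
  have hsimple : ∀ i, IsSimpleModule Q (Q ⧸ 𝔪 i) := fun i =>
    isSimpleModule_iff_isCoatom.mpr (h𝔪 i).1
  have hfinS : ∀ i, Module.Finite (Module.End Q (Q ⧸ 𝔪 i)) (Q ⧸ 𝔪 i) := fun i =>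
    module_finite_end_of_isSimpleModule J hJ _
  let a : Fin t → Submodule k Q → ℕ := fun i W => Module.finrank (Module.End Q (Q ⧸ 𝔪 i))
    (moduleRightAnnihilator (Module.End Q (Q ⧸ 𝔪 i)) (Q ⧸ 𝔪 i) W)
  let n : Fin t → ℕ := fun i => Module.finrank (Module.End Q (Q ⧸ 𝔪 i)) (Q ⧸ 𝔪 i)
  choose V hVO hV using fun i => exists_maximal_finrank ⟨W, hW⟩ (a i) (n i) fun W =>
    Submodule.finrank_le _
  -- a dense subspace with the largest annihilators in all simple modules
  set I₀ := ⨅ i, V i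
  have hI₀ : I₀ ∈ O := hO.iInf_mem hVO
  let r : Fin t → ℕ := fun i => a i I₀
  have hr : ∀ W ∈ O, ∀ i, a i W ≤ r i := fun W hW i => (hV i W hW).trans
    (Submodule.finrank_mono (moduleRightAnnihilator_anti _ _ (iInf_le V i)))
  by_cases hr0 : ∃ i, 0 < r i
  · exfalso
    have hn : ∀ i, 0 < n i := fun i => by
      have := IsSimpleModule.nontrivial Q (Q ⧸ 𝔪 i)
      exact Module.finrank_pos
    obtain ⟨j, hj0, hj⟩ := exists_ratio_maximal r n hn hr0
    have hP : leftModuleAnnihilator k (Q := Q) (Q ⧸ 𝔪 j) = ⊤ := by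
      refine eq_top_of_antipodeComap J hJ hQ hsp hnoeth hstable hfinite hO
        (isTwoSidedSubspace_leftModuleAnnihilator _) fun d C hC v hv => ?_
      set I' := I₀ ⊓ antipodeComap C I₀
      have hI' : I' ∈ O := hO.inf_mem hI₀ (hO.iInf_mem fun p => hO.comap_antipode_mem hI₀ _)
      obtain ⟨f, hf⟩ := exists_surjective_pi_of_finrank_le J hJ (Z := Q ⧸ Ideal.span (I' : Set Q))
        (r j) (n j) fun 𝔫 h𝔫 => by
          obtain ⟨i, ⟨e⟩⟩ := hiso 𝔫 h𝔫
          rw [finrank_linearMap_end_eq_of_equiv _ e, finrank_end_eq_of_equiv e]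
          calc n j * _ ≤ n j * r i := Nat.mul_le_mul_left _
                ((finrank_quotient_linearMap_le _ _ I').trans (hr I' hI' i))
            _ = r i * n j := mul_comm _ _
            _ ≤ r j * n i := hj i
      have hker : ∀ x, f x = 0 → ∀ t, x t ∈ antipodeComap C
          (leftModuleAnnihilator k (Q := Q) (Q ⧸ 𝔪 j)) := fun x hx t =>
        mem_antipodeComap.mpr fun i i' s => antipode_smul_smul_eq_zero_of_map_eq_zero hQ hC
          (moduleRightAnnihilator (Module.End Q (Q ⧸ 𝔪 j)) (Q ⧸ 𝔪 j) I₀)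
          (fun i i' w hw s hs => hs _ (mem_antipodeComap.mp hw.2 i i')) f hf (mul_comm _ _) hx
          t i i' s
      -- `q ↦ q 0 * v` factors through a power of `Q ⧸ Q I'`, which has no maps to `Q`
      let u : (Fin (r j) → Q) →ₗ[Q] Q :=
        LinearMap.toSpanSingleton Q Q v ∘ₗ LinearMap.proj ⟨0, hj0⟩
      obtain ⟨g, hg⟩ := exists_factor_of_ker_le f hf u fun x hx => hv _ (hker x hx _)
      have hg0 : g = 0 := LinearMap.pi_ext' fun p => by
        refine LinearMap.ext fun x => ?_
        obtain ⟨q, rfl⟩ := Submodule.Quotient.mk_surjective _ x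
        set φ := g ∘ₗ LinearMap.single Q (fun _ => Q ⧸ Ideal.span (I' : Set Q)) p
        have hφ : ∀ q : Q, φ (Submodule.Quotient.mk q) = q * φ (Submodule.Quotient.mk 1) :=
          fun q => by
            rw [← smul_eq_mul q (φ _), ← map_smul, ← Submodule.Quotient.mk_smul, smul_eq_mul,
              mul_one]
        have h1 : φ (Submodule.Quotient.mk 1) = 0 :=
          hO.eq_zero_of_mul_eq_zero' hI' _ fun w hw => by
            rw [← hφ, (Submodule.Quotient.mk_eq_zero _).mpr (Ideal.subset_span hw), map_zero]
        rw [hφ, h1, mul_zero]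
        rfl
      have h1 := hg fun _ => 1
      rw [hg0, LinearMap.zero_apply] at h1
      have h2 : u (fun _ => 1) = v := one_mul v
      rw [← h2, ← h1]
    have := IsSimpleModule.nontrivial Q (Q ⧸ 𝔪 j)
    obtain ⟨s, hs⟩ := exists_ne (0 : Q ⧸ 𝔪 j)
    have h1 : (1 : Q) ∈ leftModuleAnnihilator k (Q := Q) (Q ⧸ 𝔪 j) := by rw [hP]; trivial
    exact hs (by simpa using h1 s)
  · push Not at hr0
    by_contra hne
    obtain ⟨𝔫, h𝔫, hW𝔫⟩ := Ideal.exists_le_maximal _ hne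
    obtain ⟨i, ⟨e⟩⟩ := hiso 𝔫 h𝔫
    have h1 : a i W = 0 := Nat.le_zero.mp ((hr W hW i).trans (hr0 i))
    have h2 : moduleRightAnnihilator (Module.End Q (Q ⧸ 𝔪 i)) (Q ⧸ 𝔪 i) W = ⊥ :=
      Submodule.finrank_eq_zero.mp h1
    have h3 : e (Submodule.Quotient.mk 1) ∈
        moduleRightAnnihilator (Module.End Q (Q ⧸ 𝔪 i)) (Q ⧸ 𝔪 i) W := fun w hw => by
      rw [← map_smul, ← Submodule.Quotient.mk_smul, smul_eq_mul, mul_one,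
        (Submodule.Quotient.mk_eq_zero _).mpr (hW𝔫 (Ideal.subset_span hw)), map_zero]
    rw [h2, Submodule.mem_bot, LinearEquiv.map_eq_zero_iff, Submodule.Quotient.mk_eq_zero] at h3
    exact h𝔫.ne_top ((Ideal.eq_top_iff_one 𝔫).mpr h3)

end LeftSpanTop

/-! ### Essential right ideals of subrings of semisimple rings -/

section Essential

variable {B : Type*} [Ring B]

/-- `E` is a right ideal of the subring `R` of `B` which is essential in `B` as a right
`R`-module. -/
structure IsEssentialRightIdeal (R : Subring B) (E : AddSubgroup B) : Prop where
  le : ∀ x ∈ E, x ∈ R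
  mul_mem : ∀ x ∈ E, ∀ r ∈ R, x * r ∈ E
  exists_mul_mem : ∀ x : B, x ≠ 0 → ∃ r ∈ R, x * r ≠ 0 ∧ x * r ∈ E

namespace IsEssentialRightIdeal

variable {R : Subring B} {E : AddSubgroup B}

theorem self_of_le (hE : IsEssentialRightIdeal R E) : IsEssentialRightIdeal R R.toAddSubgroup :=
  ⟨fun _ h => h, fun _ hx _ hr => R.mul_mem hx hr, fun x hx => by
    obtain ⟨r, hr, h0, hE'⟩ := hE.exists_mul_mem x hx
    exact ⟨r, hr, h0, hE.le _ hE'⟩⟩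

/-- The right ideal `(E : q)` of `R`. -/
theorem quotient (hE : IsEssentialRightIdeal R E) (q : B) :
    IsEssentialRightIdeal R (R.toAddSubgroup ⊓ E.comap (AddMonoidHom.mulLeft q)) := by
  refine ⟨fun x hx => hx.1, fun x hx r hr => ⟨R.mul_mem hx.1 hr, ?_⟩, fun x hx => ?_⟩
  · change q * (x * r) ∈ E
    rw [← mul_assoc]
    exact hE.mul_mem _ hx.2 r hr
  · obtain ⟨r, hr, h0, hrE⟩ := hE.exists_mul_mem x hx
    by_cases hq : q * (x * r) = 0
    · refine ⟨r, hr, h0, hE.le _ hrE, ?_⟩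
      change q * (x * r) ∈ E
      rw [hq]
      exact E.zero_mem
    · obtain ⟨r', hr', h0', hrE'⟩ := hE.exists_mul_mem _ hq
      rw [mul_assoc] at h0' hrE'
      refine ⟨r * r', R.mul_mem hr hr', ?_, ?_, ?_⟩
      · rw [← mul_assoc]
        intro h
        exact h0' (by rw [h, mul_zero])
      · rw [← mul_assoc]
        exact R.mul_mem (hE.le _ hrE) hr'
      · change q * (x * (r * r')) ∈ E
        rw [← mul_assoc x]
        exact hrE'

variable [IsSemisimpleRing B]

theorem span_op_eq_top (hE : IsEssentialRightIdeal R E) :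
    Submodule.span Bᵐᵒᵖ (E : Set B) = ⊤ := by
  obtain ⟨C, hC⟩ := exists_isCompl (Submodule.span Bᵐᵒᵖ (E : Set B))
  have : C = ⊥ := by
    refine eq_bot_iff.mpr fun c hc => ?_
    by_contra hc0
    obtain ⟨r, -, h0, hrE⟩ := hE.exists_mul_mem c hc0
    exact h0 (Submodule.disjoint_def.mp hC.disjoint _ (Submodule.subset_span hrE)
      (C.smul_mem (MulOpposite.op r) hc))
  simpa [this] using hC.sup_eq_top

theorem eq_zero_of_forall_mul_eq_zero (hE : IsEssentialRightIdeal R E) {q : B}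
    (hq : ∀ e ∈ E, q * e = 0) : q = 0 := by
  have h : ∀ x ∈ Submodule.span Bᵐᵒᵖ (E : Set B), q * x = 0 := by
    intro x hx
    induction hx using Submodule.span_induction with
    | mem x hx => exact hq x hx
    | zero => rw [mul_zero]
    | add x y _ _ hx hy => rw [mul_add, hx, hy, add_zero]
    | smul c x _ hx => rw [mul_smul_comm, hx, smul_zero]
  simpa using h 1 (by rw [hE.span_op_eq_top]; trivial)

end IsEssentialRightIdeal

/-- The right annihilator of an additive subgroup. -/
def rightAnnihilatorOp (E : AddSubgroup B) : Submodule Bᵐᵒᵖ B where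
  carrier := {y | ∀ e ∈ E, e * y = 0}
  add_mem' ha hb e he := by rw [mul_add, ha e he, hb e he, add_zero]
  zero_mem' e _ := mul_zero e
  smul_mem' c y hy e he := by rw [mul_smul_comm, hy e he, smul_zero]

/-- An element of a semisimple ring that is not a left zero divisor is invertible. -/
theorem isUnit_of_forall_mul_eq_zero [IsArtinian Bᵐᵒᵖ B] {s : B} (hs : ∀ x, s * x = 0 → x = 0) :
    IsUnit s := by
  let f : B →ₗ[Bᵐᵒᵖ] B :=
    { toFun := fun x => s * x
      map_add' := fun x y => mul_add s x y
      map_smul' := fun c x => mul_smul_comm c s x }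
  have hinj : Function.Injective f := (injective_iff_map_eq_zero f).mpr hs
  obtain ⟨b, hb⟩ := IsArtinian.surjective_of_injective_endomorphism f hinj 1
  have hb' : s * b = 1 := hb
  refine ⟨⟨s, b, hb', sub_eq_zero.mp (hs _ ?_)⟩, rfl⟩
  rw [mul_sub, ← mul_assoc, hb', one_mul, mul_one, sub_self]

variable [IsSemisimpleRing B] {R : Subring B}

/-- Let `Y` be a right ideal of the semisimple ring `B` which is stable under left multiplication
by the subring `R`. If essential right ideals of `R` have zero right annihilators in `B` then `Y`
is a two-sided ideal of `B`: the ideal `Y ∩ R` of `R` has an annihilator that generates a complement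
of `Y`, and the projection onto `Y` commutes with `R`, hence with `B`. -/
theorem mul_mem_of_subring_mul_mem (hR : IsEssentialRightIdeal R R.toAddSubgroup)
    (hann : ∀ E, IsEssentialRightIdeal R E → ∀ q : B, (∀ e ∈ E, e * q = 0) → q = 0)
    (Y : Submodule Bᵐᵒᵖ B) (hY : ∀ r ∈ R, ∀ y ∈ Y, r * y ∈ Y) (q : B) {y : B} (hy : y ∈ Y) :
    q * y ∈ Y := by
  have hYr : ∀ y ∈ Y, ∀ b, y * b ∈ Y := fun y hy b => Y.smul_mem (MulOpposite.op b) hy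
  -- the left annihilator of `Y ∩ R` in `R`
  let l : AddSubgroup B :=
    { carrier := {a | a ∈ R ∧ ∀ y ∈ Y, y ∈ R → a * y = 0}
      add_mem' := fun {a b} ha hb => ⟨R.add_mem ha.1 hb.1, fun y hy hyR => by
        rw [add_mul, ha.2 y hy hyR, hb.2 y hy hyR, add_zero]⟩
      zero_mem' := ⟨R.zero_mem, fun y _ _ => zero_mul y⟩
      neg_mem' := fun {a} ha => ⟨R.neg_mem ha.1, fun y hy hyR => by
        rw [neg_mul, ha.2 y hy hyR, neg_zero]⟩ }
  have hlr : ∀ a ∈ l, ∀ r ∈ R, a * r ∈ l := fun a ha r hr =>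
    ⟨R.mul_mem ha.1 hr, fun y hy hyR => by
      rw [mul_assoc]; exact ha.2 _ (hY r hr y hy) (R.mul_mem hr hyR)⟩
  have hll : ∀ a ∈ l, ∀ r ∈ R, r * a ∈ l := fun a ha r hr =>
    ⟨R.mul_mem hr ha.1, fun y hy hyR => by rw [mul_assoc, ha.2 y hy hyR, mul_zero]⟩
  -- `Y ∩ l` is a nilpotent ideal of `R`, hence zero
  have hYl : ∀ w, w ∈ Y → w ∈ l → w = 0 := by
    let W : AddSubgroup B :=
      { carrier := {a | a ∈ R ∧ ∀ w ∈ Y, w ∈ l → a * w = 0}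
        add_mem' := fun {a b} ha hb => ⟨R.add_mem ha.1 hb.1, fun y hy hyR => by
          rw [add_mul, ha.2 y hy hyR, hb.2 y hy hyR, add_zero]⟩
        zero_mem' := ⟨R.zero_mem, fun y _ _ => zero_mul y⟩
        neg_mem' := fun {a} ha => ⟨R.neg_mem ha.1, fun y hy hyR => by
          rw [neg_mul, ha.2 y hy hyR, neg_zero]⟩ }
    have hW : IsEssentialRightIdeal R W := by
      refine ⟨fun x hx => hx.1, fun x hx r hr => ⟨R.mul_mem hx.1 hr, fun w hw hwl => ?_⟩,
        fun x hx => ?_⟩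
      · rw [mul_assoc]
        exact hx.2 _ (hY r hr w hw) (hll w hwl r hr)
      · obtain ⟨r, hr, h0, hrR⟩ := hR.exists_mul_mem x hx
        by_cases h : ∀ w ∈ Y, w ∈ l → x * r * w = 0
        · exact ⟨r, hr, h0, hrR, h⟩
        · push Not at h
          obtain ⟨w, hwY, hwl, hw0⟩ := h
          refine ⟨r * w, R.mul_mem hr hwl.1, by rwa [← mul_assoc], ?_, fun v hvY hvl => ?_⟩
          · rw [← mul_assoc]
            exact R.mul_mem hrR hwl.1
          · rw [← mul_assoc, mul_assoc, hwl.2 v hvY hvl.1, mul_zero]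
    exact fun w hwY hwl => hann W hW w fun a ha => ha.2 w hwY hwl
  have hsum : IsEssentialRightIdeal R ((Y.toAddSubgroup ⊓ R.toAddSubgroup) ⊔ l) := by
    refine ⟨fun x hx => ?_, fun x hx r hr => ?_, fun x hx => ?_⟩
    · obtain ⟨y, hy, a, ha, rfl⟩ := AddSubgroup.mem_sup.mp hx
      exact R.add_mem hy.2 ha.1
    · obtain ⟨y, hy, a, ha, rfl⟩ := AddSubgroup.mem_sup.mp hx
      rw [add_mul]
      exact AddSubgroup.mem_sup.mpr ⟨_, ⟨hYr y hy.1 r, R.mul_mem hy.2 hr⟩, _, hlr a ha r hr, rfl⟩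
    · obtain ⟨r, hr, h0, hrR⟩ := hR.exists_mul_mem x hx
      by_cases h : ∀ y ∈ Y, y ∈ R → x * r * y = 0
      · exact ⟨r, hr, h0, (le_sup_right : l ≤ _) ⟨hrR, h⟩⟩
      · push Not at h
        obtain ⟨y, hyY, hyR, hy0⟩ := h
        refine ⟨r * y, R.mul_mem hr hyR, by rwa [← mul_assoc],
          (le_sup_left : Y.toAddSubgroup ⊓ R.toAddSubgroup ≤ _) ⟨?_, ?_⟩⟩
        · rw [← mul_assoc]
          exact hY _ hrR y hyY
        · rw [← mul_assoc]
          exact R.mul_mem hrR hyR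
  set L : Submodule Bᵐᵒᵖ B := Submodule.span Bᵐᵒᵖ (l : Set B) with hL
  have hLr : ∀ y ∈ L, ∀ b, y * b ∈ L := fun y hy b => L.smul_mem (MulOpposite.op b) hy
  have hLl : ∀ r ∈ R, ∀ x ∈ L, r * x ∈ L := by
    intro r hr x hx
    induction hx using Submodule.span_induction with
    | mem x hx => exact Submodule.subset_span (hll x hx r hr)
    | zero => rw [mul_zero]; exact L.zero_mem
    | add x y _ _ hx hy => rw [mul_add]; exact L.add_mem hx hy
    | smul c x _ hx => rw [mul_smul_comm]; exact L.smul_mem c hx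
  have htop : Y ⊔ L = ⊤ := by
    rw [eq_top_iff, ← hsum.span_op_eq_top]
    refine Submodule.span_le.mpr fun x hx => ?_
    obtain ⟨y, hy, a, ha, rfl⟩ := AddSubgroup.mem_sup.mp hx
    exact Submodule.add_mem_sup hy.1 (Submodule.subset_span ha)
  have hdisj : ∀ z ∈ Y, z ∈ L → z = 0 := by
    intro z hzY hzL
    by_contra hz0
    obtain ⟨r, hr, h0, hrR⟩ := hR.exists_mul_mem z hz0
    have h1 : ∀ x ∈ L, ∀ y ∈ Y, y ∈ R → y * x = 0 := by
      intro x hx y hy hyR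
      induction hx using Submodule.span_induction with
      | mem x hx => exact hYl _ (hYr y hy x) (hll x hx y hyR)
      | zero => rw [mul_zero]
      | add x x' _ _ hx hx' => rw [mul_add, hx, hx', add_zero]
      | smul c x _ hx => rw [mul_smul_comm, hx, smul_zero]
    refine h0 (hann _ hsum _ fun e he => ?_)
    obtain ⟨y, hy, a, ha, rfl⟩ := AddSubgroup.mem_sup.mp he
    rw [add_mul, h1 _ (hLr z hzL r) y hy.1 hy.2, ha.2 _ (hYr z hzY r) hrR, add_zero]
  obtain ⟨p, hp, p', hp', hpp⟩ := Submodule.mem_sup.mp (htop.ge (Submodule.mem_top (x := (1 : B))))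
  have hcomm : ∀ x ∈ R, p * x = x * p := by
    intro x hx
    have h1 : p * x - x * p = x * p' - p' * x := by
      rw [sub_eq_sub_iff_add_eq_add, ← mul_add, add_comm p', hpp, ← add_mul, hpp, one_mul, mul_one]
    refine sub_eq_zero.mp (hdisj _ (Y.sub_mem (hYr p hp x) (hY x hx p hp)) ?_)
    rw [h1]
    exact L.sub_mem (hLl x hx p' hp') (hLr p' hp' x)
  have hcentral : p * q = q * p := by
    refine sub_eq_zero.mp ((hR.quotient q).eq_zero_of_forall_mul_eq_zero fun a ha => ?_)
    have h2 : q * a ∈ R := ha.2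
    rw [sub_mul, mul_assoc, hcomm _ h2, mul_assoc q p, hcomm a ha.1, mul_assoc, sub_self]
  have hpy : y = p * y := by
    have h1 : y - p * y = p' * y := by
      rw [sub_eq_iff_eq_add, ← add_mul, add_comm, hpp, one_mul]
    refine sub_eq_zero.mp (hdisj _ (Y.sub_mem hy (hYr p hp y)) ?_)
    rw [h1]
    exact hLr p' hp' y
  rw [hpy, ← mul_assoc, ← hcentral, mul_assoc]
  exact hYr p hp _

/-- If essential right ideals of the subring `R` of the semisimple ring `B` have zero right
annihilators in `B` then each of them contains a unit of `B`, namely each element whose right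
annihilator is minimal. -/
theorem exists_isUnit_mem_of_isEssentialRightIdeal
    (hann : ∀ E, IsEssentialRightIdeal R E → ∀ q : B, (∀ e ∈ E, e * q = 0) → q = 0)
    {E : AddSubgroup B} (hE : IsEssentialRightIdeal R E) : ∃ s ∈ E, IsUnit s := by
  have hfin := module_finite_op_self (Q := B)
  have hR := hE.self_of_le
  let ann : B → Submodule Bᵐᵒᵖ B := fun s => rightAnnihilatorOp (AddSubgroup.zmultiples s)
  have hmem : ∀ s x, x ∈ ann s ↔ s * x = 0 := fun s x => by
    refine ⟨fun h => h s (AddSubgroup.mem_zmultiples s), ?_⟩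
    rintro h _ ⟨n, rfl⟩
    change n • s * x = 0
    rw [smul_mul_assoc, h, smul_zero]
  obtain ⟨_, ⟨⟨s, hsE⟩, rfl⟩, hs⟩ := (wellFounded_lt (α := Submodule Bᵐᵒᵖ B)).has_min
    (Set.range fun s : E => ann s) ⟨_, ⟨0, E.zero_mem⟩, rfl⟩
  refine ⟨s, hsE, isUnit_of_forall_mul_eq_zero fun x hx => ?_⟩
  obtain ⟨C, hC⟩ := exists_isCompl (Submodule.span Bᵐᵒᵖ {s})
  have hsC : ∀ a, s * a ∈ C → s * a = 0 := fun a ha =>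
    Submodule.disjoint_def.mp hC.disjoint _
      (Submodule.smul_mem _ (MulOpposite.op a) (Submodule.mem_span_singleton_self s)) ha
  -- by minimality, elements of `E ∩ C` are killed by the right annihilator of `s`
  have hCx : ∀ c ∈ E, c ∈ C → ∀ x, s * x = 0 → c * x = 0 := by
    intro c hcE hcC x hx
    have hle : ann (s + c) ≤ ann s := fun z hz => by
      rw [hmem, add_mul] at hz
      rw [hmem]
      refine hsC z ?_
      rw [eq_neg_of_add_eq_zero_left hz]
      exact C.neg_mem (C.smul_mem (MulOpposite.op z) hcC)
    have heq : ann (s + c) = ann s := by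
      by_contra hne
      exact hs _ ⟨⟨s + c, E.add_mem hsE hcE⟩, rfl⟩ (lt_of_le_of_ne hle hne)
    have h1 : x ∈ ann (s + c) := by rw [heq, hmem]; exact hx
    rwa [hmem, add_mul, hx, zero_add] at h1
  set Y : Submodule Bᵐᵒᵖ B := rightAnnihilatorOp (E ⊓ C.toAddSubgroup) with hYdef
  have hYl : ∀ q, ∀ y ∈ Y, q * y ∈ Y := fun q y hy =>
    mul_mem_of_subring_mul_mem hR hann Y (fun r hr y hy e he => by
      rw [← mul_assoc]
      exact hy _ ⟨hE.mul_mem e he.1 r hr, C.smul_mem (MulOpposite.op r) he.2⟩) q hy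
  have hCY : ∀ c ∈ C, ∀ y ∈ Y, c * y = 0 := by
    intro c hc y hy
    have h2 : ∀ x ∈ Submodule.span Bᵐᵒᵖ
        ((R.toAddSubgroup ⊓ E.comap (AddMonoidHom.mulLeft c) : AddSubgroup B) : Set B),
        ∀ y ∈ Y, c * x * y = 0 := by
      intro x hx
      induction hx using Submodule.span_induction with
      | mem x hx => exact fun y hy => hy _ ⟨hx.2, C.smul_mem (MulOpposite.op x) hc⟩
      | zero => intro y _; rw [mul_zero, zero_mul]
      | add x x' _ _ hx hx' => intro y hy; rw [mul_add, add_mul, hx y hy, hx' y hy, add_zero]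
      | smul b x _ hx =>
        intro y hy
        have := hx _ (hYl b.unop y hy)
        rwa [← mul_assoc, mul_assoc c] at this
    simpa using h2 1 (by rw [(hE.quotient c).span_op_eq_top]; trivial) y hy
  -- left multiplication by `s` maps `Y` onto itself
  let f : Y →ₗ[Bᵐᵒᵖ] Y :=
    { toFun := fun y => ⟨s * y, hYl s y y.2⟩
      map_add' := fun x y => Subtype.ext (mul_add s x y)
      map_smul' := fun c x => Subtype.ext (mul_smul_comm c s (x : B)) }
  have hf : Function.Surjective f := by
    rintro ⟨y, hy⟩
    obtain ⟨a, ha, c, hc, hac⟩ := Submodule.mem_sup.mp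
      (hC.sup_eq_top.ge (Submodule.mem_top (x := (1 : B))))
    obtain ⟨b, rfl⟩ := Submodule.mem_span_singleton.mp ha
    refine ⟨⟨b.unop * y, hYl _ y hy⟩, Subtype.ext ?_⟩
    change s * (b.unop * y) = y
    conv_rhs => rw [← one_mul y, ← hac, add_mul, hCY c hc y hy, add_zero]
    rw [← mul_assoc]
    rfl
  have hinj := IsNoetherian.injective_of_surjective_endomorphism f hf
  have hxY : x ∈ Y := fun c hc => hCx c hc.1 hc.2 x hx
  have h1 : (⟨x, hxY⟩ : Y) = 0 := hinj (Subtype.ext (by simpa [f] using hx))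
  exact congrArg Subtype.val h1

end Essential

/-! ### The classical quotient ring -/

section Quotient

variable {k H Q : Type*} [Field k] [Ring H] [HopfAlgebra k H] [Ring Q] [Algebra k Q]
  [Module H Q] [IsScalarTower k H Q] {A : Subalgebra k Q} {O : Set (Submodule k Q)}

theorem isUnit_of_isUnit_quotient {R : Type*} [Ring R] (J : Ideal R) [J.IsTwoSided] {N : ℕ}
    (hJ : J ^ N = ⊥) {s : R} (hs : IsUnit (Ideal.Quotient.mk J s)) : IsUnit s := by
  have hnil : ∀ x ∈ J, IsUnit (1 + x) := fun x hx => by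
    refine IsNilpotent.isUnit_one_add ⟨N, ?_⟩
    have key : ∀ n : ℕ, x ^ n ∈ J ^ n := fun n => by
      induction n with
      | zero => simp [Submodule.pow_zero, Ideal.one_eq_top]
      | succ n ih => rw [pow_succ, Submodule.pow_succ]; exact Submodule.mul_mem_mul ih hx
    have := key N
    rwa [hJ] at this
  obtain ⟨u, hu⟩ := hs
  obtain ⟨b, hb⟩ := Ideal.Quotient.mk_surjective (u⁻¹ : (R ⧸ J)ˣ).val
  have h1 : IsUnit (s * b) := by
    have : s * b - 1 ∈ J := by
      rw [← Ideal.Quotient.eq_zero_iff_mem, map_sub, map_mul, hb, ← hu, map_one, Units.mul_inv,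
        sub_self]
    simpa using hnil _ this
  have h2 : IsUnit (b * s) := by
    have : b * s - 1 ∈ J := by
      rw [← Ideal.Quotient.eq_zero_iff_mem, map_sub, map_mul, hb, ← hu, map_one, Units.inv_mul,
        sub_self]
    simpa using hnil _ this
  obtain ⟨v, hv⟩ := h1
  obtain ⟨w, hw⟩ := h2
  exact isUnit_iff_exists_and_exists.mpr
    ⟨⟨b * (v⁻¹ : Rˣ).val, by rw [← mul_assoc, ← hv, Units.mul_inv]⟩,
      ⟨(w⁻¹ : Rˣ).val * b, by rw [mul_assoc, ← hw, Units.inv_mul]⟩⟩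

/-- An element that is not a left zero divisor is invertible, when the ring is semisimple modulo a
nilpotent ideal. -/
theorem isUnit_of_forall_mul_eq_zero_of_semiprimary {R : Type*} [Ring R] (J : Ideal Rᵐᵒᵖ)
    [J.IsTwoSided] [IsSemisimpleRing (Rᵐᵒᵖ ⧸ J)] {N : ℕ} (hJ : J ^ N = ⊥) {s : R}
    (hs : ∀ x, s * x = 0 → x = 0) : IsUnit s := by
  obtain ⟨m, hm⟩ := exists_stable_of_antitone_fg J hJ (fun n => Submodule.span Rᵐᵒᵖ {s ^ n})
    (antitone_nat_of_succ_le fun n => by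
      rw [Submodule.span_singleton_le_iff_mem, pow_succ]
      exact Submodule.smul_mem _ (MulOpposite.op s) (Submodule.mem_span_singleton_self _))
    fun n => Submodule.fg_span_singleton _
  have h1 : s ^ m ∈ Submodule.span Rᵐᵒᵖ {s ^ (m + 1)} := by
    rw [hm (m + 1) (Nat.le_succ m)]
    exact Submodule.mem_span_singleton_self _
  obtain ⟨b, hb⟩ := Submodule.mem_span_singleton.mp h1
  have hpow : ∀ n x, s ^ n * x = 0 → x = 0 := by
    intro n
    induction n with
    | zero => intro x hx; simpa using hx
    | succ n ih => intro x hx; rw [pow_succ, mul_assoc] at hx; exact hs _ (ih _ hx)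
  have hb' : s * b.unop = 1 := by
    refine sub_eq_zero.mp (hpow m _ ?_)
    have hb2 : s ^ (m + 1) * b.unop = s ^ m := hb
    rw [mul_sub, ← mul_assoc, ← pow_succ, hb2, mul_one, sub_self]
  refine isUnit_iff_exists_and_exists.mpr ⟨⟨_, hb'⟩, ⟨b.unop, sub_eq_zero.mp (hs _ ?_)⟩⟩
  rw [mul_sub, ← mul_assoc, hb', one_mul, mul_one, sub_self]

/-- Each member of the Gabriel topology contains an element invertible modulo `J`. -/
theorem exists_isUnit_quotient_mem (J : Ideal Q) [J.IsTwoSided] [IsSemisimpleRing (Q ⧸ J)]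
    {N : ℕ} (hJ : J ^ N = ⊥) (hQ : IsHopfModuleAlgebra k H Q) (hsp : IsHopfSemiprime H Q)
    (hnoeth : IsNoetherian Aᵐᵒᵖ A) (hstable : ∀ (h : H), ∀ a ∈ A, h • a ∈ A)
    (hfinite : ∀ a ∈ A, FiniteDimensional k (LinearMap.range (hopfOrbitMap k H a)))
    (G : Set (RightIdeal A)) (hO : IsDenseFilter k H A (denseFilter k A G)) {I : RightIdeal A}
    (hI : I ∈ G) : ∃ s ∈ I, IsUnit (Ideal.Quotient.mk J (s : Q)) := by
  let π := Ideal.Quotient.mk J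
  let φ : A →+* Q ⧸ J := π.comp A.val.toRingHom
  let W : Submodule k Q :=
    { carrier := {x | ∃ y ∈ I, (y : Q) = x}
      add_mem' := by
        rintro _ _ ⟨y, hy, rfl⟩ ⟨z, hz, rfl⟩
        exact ⟨y + z, I.add_mem hy hz, rfl⟩
      zero_mem' := ⟨0, I.zero_mem, rfl⟩
      smul_mem' := by
        rintro c _ ⟨y, hy, rfl⟩
        refine ⟨MulOpposite.op (algebraMap k A c) • y, I.smul_mem _ hy, ?_⟩
        change (y : Q) * algebraMap k Q c = c • (y : Q)
        rw [← Algebra.commutes, Algebra.smul_def] }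
  have hW : W ∈ denseFilter k A G := ⟨I, hI, fun x hx => ⟨x, hx, rfl⟩⟩
  have hE : IsEssentialRightIdeal φ.range (I.toAddSubgroup.map φ.toAddMonoidHom) := by
    refine ⟨?_, ?_, fun x hx => ?_⟩
    · rintro _ ⟨y, -, rfl⟩
      exact ⟨y, rfl⟩
    · rintro _ ⟨y, hy, rfl⟩ _ ⟨r, rfl⟩
      exact ⟨y * r, I.smul_mem (MulOpposite.op r) hy, map_mul φ y r⟩
    · obtain ⟨q, rfl⟩ := Ideal.Quotient.mk_surjective x
      by_contra! hcon
      have hV := hO.inf_mem hW (hO.comap_mulLeft_mem hW q)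
      have htop := span_op_eq_top J hJ hQ hsp hnoeth hstable hfinite hO hV
      have hzero : ∀ x ∈ Submodule.span Qᵐᵒᵖ
          ((W ⊓ W.comap (LinearMap.mulLeft k q) : Submodule k Q) : Set Q), π (q * x) = 0 := by
        intro x hx
        induction hx using Submodule.span_induction with
        | mem x hx =>
          obtain ⟨⟨y, hy, rfl⟩, z, hz, hzq⟩ := hx
          by_contra hne
          rw [map_mul] at hne
          refine hcon (φ y) ⟨y, rfl⟩ hne ⟨z, hz, ?_⟩
          change π (z : Q) = π q * π y
          rw [hzq, ← map_mul]
          rfl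
        | zero => rw [mul_zero, map_zero]
        | add x y _ _ hx hy => rw [mul_add, map_add, hx, hy, add_zero]
        | smul c x _ hx =>
          rw [mul_smul_comm]
          change π (q * x * c.unop) = 0
          rw [map_mul, hx, zero_mul]
      have := hzero 1 (by rw [htop]; trivial)
      rw [mul_one] at this
      exact hx this
  have hann : ∀ E, IsEssentialRightIdeal φ.range E → ∀ q : Q ⧸ J, (∀ e ∈ E, e * q = 0) → q = 0 := by
    intro E hE q hq
    -- an essential right ideal contains the image of a member of the Gabriel topology
    have hdense : ∀ x ∈ Submodule.span (Q ⧸ J)ᵐᵒᵖ (E : Set (Q ⧸ J)),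
        ∃ V ∈ denseFilter k A G, ∀ w ∈ V, x * π w ∈ E := by
      intro x hx
      induction hx using Submodule.span_induction with
      | mem x hx =>
        exact ⟨_, hO.toSubmodule_mem, fun w hw => hE.mul_mem x hx _ ⟨⟨w, hw⟩, rfl⟩⟩
      | zero => exact ⟨_, hO.toSubmodule_mem, fun w _ => by rw [zero_mul]; exact E.zero_mem⟩
      | add x y _ _ hx hy =>
        obtain ⟨V, hV, hVx⟩ := hx
        obtain ⟨V', hV', hVy⟩ := hy
        exact ⟨_, hO.inf_mem hV hV', fun w hw => by
          rw [add_mul]; exact E.add_mem (hVx w hw.1) (hVy w hw.2)⟩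
      | smul c x _ hx =>
        obtain ⟨V, hV, hVx⟩ := hx
        obtain ⟨b, hb⟩ := Ideal.Quotient.mk_surjective c.unop
        refine ⟨_, hO.comap_mulLeft_mem hV b, fun w hw => ?_⟩
        have h1 := hVx _ hw
        change x * c.unop * π w ∈ E
        rw [← hb, mul_assoc, ← map_mul]
        exact h1
    obtain ⟨V, hV, hVE⟩ := hdense 1 (by rw [hE.span_op_eq_top]; trivial)
    have htop := ideal_span_eq_top J hJ hQ hsp hnoeth hstable hfinite hO hV
    have hzero : ∀ x ∈ Ideal.span (V : Set Q), π x * q = 0 := by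
      intro x hx
      induction hx using Submodule.span_induction with
      | mem x hx =>
        have := hVE x hx
        rw [one_mul] at this
        exact hq _ this
      | zero => rw [map_zero, zero_mul]
      | add x y _ _ hx hy => rw [map_add, add_mul, hx, hy, add_zero]
      | smul c x _ hx => rw [smul_eq_mul, map_mul, mul_assoc, hx, mul_zero]
    simpa using hzero 1 (by rw [htop]; trivial)
  obtain ⟨_, ⟨s, hs, rfl⟩, hu⟩ := exists_isUnit_mem_of_isEssentialRightIdeal hann hE
  exact ⟨s, hs, hu⟩

end Quotient

theorem proposition3p9 {k H Q : Type*} [Field k] [Ring H] [HopfAlgebra k H]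
    [Ring Q] [Algebra k Q] [Module H Q] [IsScalarTower k H Q]
    -- `Q` is a semiprimary `H`-semiprime `H`-module algebra
    (hQ : IsHopfModuleAlgebra k H Q) (hsemiprimary : IsSemiprimaryRing Q)
    (hsemiprime : IsHopfSemiprime H Q)
    -- `A` is a right Noetherian `H`-stable subalgebra on which the action is locally finite
    (A : Subalgebra k Q) (hnoeth : IsNoetherian (A)ᵐᵒᵖ A)
    (hstable : ∀ (h : H), ∀ a ∈ A, h • a ∈ A)
    (hfinite : ∀ a ∈ A, FiniteDimensional k (LinearMap.range (hopfOrbitMap k H a)))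
    -- `G` is a right Gabriel topology on `A` such that `S(H)` acts by continuous transformations
    (G : Set (RightIdeal A)) (hG : IsRightGabrielTopology G)
    (hcont : ∀ (h : H), h ∈ LinearMap.range (HopfAlgebra.antipode k (A := H)) →
      IsGabrielContinuous G (fun a : A => ⟨h • (a : Q), hstable h a a.2⟩))
    -- `lann_Q I = 0` and `rann_A I = 0` for each `I ∈ G`
    (hlann : ∀ I ∈ G, ∀ q : Q, (∀ x ∈ I, q * (x : Q) = 0) → q = 0)
    (hrann : ∀ I ∈ G, ∀ a : A, (∀ x ∈ I, x * a = 0) → a = 0)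
    -- each `q ∈ Q` satisfies `q I ⊆ A` for some `I ∈ G`
    (hfrac : ∀ q : Q, ∃ I ∈ G, ∀ x ∈ I, q * (x : Q) ∈ A) :
    IsClassicalRightQuotientRing A.toSubring := by
  have hss : IsSemisimpleRing (Q ⧸ Ring.jacobson Q) := hsemiprimary.isSemisimpleRing
  obtain ⟨N, hN⟩ := hsemiprimary.isNilpotent
  have hJ : Ring.jacobson Q ^ N = ⊥ := hN
  obtain ⟨J', _, _, hJ'⟩ := exists_opposite_ideal _ hJ
  have hO := isDenseFilter_denseFilter k A hstable G hG hcont hlann hrann hfrac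
  refine ⟨fun s hs => ?_, fun q => ?_⟩
  · refine isUnit_of_forall_mul_eq_zero_of_semiprimary J' hJ' fun q hq => ?_
    obtain ⟨I, hI, hqI⟩ := hfrac q
    refine hlann I hI q fun x hx => ?_
    let y : A.toSubring := ⟨q * x, hqI x hx⟩
    have hy : s * y = s * 0 := Subtype.ext (by
      change (s : Q) * (q * x) = s * 0
      rw [← mul_assoc, hq, zero_mul, mul_zero])
    exact congrArg Subtype.val (hs.left hy)
  · obtain ⟨I, hI, hqI⟩ := hfrac q
    obtain ⟨s, hs, hu⟩ := exists_isUnit_quotient_mem _ hJ hQ hsemiprime hnoeth hstable hfinite G hO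
      hI
    obtain ⟨u, hu⟩ := isUnit_of_isUnit_quotient _ hJ hu
    refine ⟨⟨q * s, hqI s hs⟩, ⟨s, s.2⟩, ⟨fun x y hxy => ?_, fun x y hxy => ?_⟩, u, hu, ?_⟩
    · have h1 : (s : Q) * x = s * y := congrArg Subtype.val hxy
      rw [← hu] at h1
      exact Subtype.ext (u.mul_right_inj.mp h1)
    · have h1 : (x : Q) * s = y * s := congrArg Subtype.val hxy
      rw [← hu] at h1
      exact Subtype.ext (u.mul_left_inj.mp h1)
    · change q = q * s * _
      rw [← hu, mul_assoc, Units.mul_inv, mul_one]
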